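/- **Setting.** Consider an Ising model on $p$ spins $\sigma\in\{-1,1\}^p$, $\mu(\sigma)\propto\exp\big(\sum_{\{u,v\}}\theta^*_{u,v}\sigma_u\sigma_v+\sum_u\theta^*_u\sigma_u\big)$, where the first sum is over unordered pairs of distinct sites and $\theta^*_{u,v}=\theta^*_{v,u}$. Let $E=\{(u,v)\in[p]\times[p] : u\ne v,\ \theta^*_{u,v}\neq 0\}$, let $\alpha>0$, and suppose that $|\theta^*_{u,v}|\ge\alpha$ for all $(u,v)\in E$. For estimates $\hat\theta=(\hat\theta_{u,v})_{u\ne v}$ put $\hat E=\{(u,v)\in[p]\times[p] : u\neq v,\ |\hat\theta_{u,v}|\ge\alpha/2\}$. **Algorithm.** The input is a degree $d$, $\gamma\geq 0$, a step size $\eta$, a number $T$ of iterations, and empirical statistics $\mathbb E_n[\prod_{u\in K}\sigma_u]$ for all $K\subseteq[p]$ with $|K|\le D:=d+2-(d\bmod 2)$. Each of them is an average over $n$ i.i.d. samples from $\mu$; the samples used for different $K$ may be the same or different, with any joint distribution. For each $u$, the algorithm performs projected gradient descent over local parameter vectors $\theta_u=(\theta_u,(\theta_{u,v})_{v\ne u})\in\mathbb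 R^p$: $\theta^{(1)}=0$ and $\theta^{(t+1)}=\mathcal P(\theta^{(t)}-\eta\,\tilde\nabla(\theta^{(t)}))$, where $\mathcal P$ is the Euclidean projection onto $\{\|\theta\|_1\le\gamma\}$. The approximate gradient $\tilde\nabla$ is obtained from the exact gradient of $\mathbb E[e^{-E_u}]$, $E_u=\sigma_u(\theta_u+\sum_{j\ne u}\theta_{u,j}\sigma_j)$, that is, from the components $-\mathbb E[\sigma_u\sigma_v e^{-E_u}]$ (for $v\neq u$) and $-\mathbb E[\sigma_u e^{-E_u}]$, by replacing $e^{-E_u}$ with its Taylor polynomial $\sum_{k\le d}(-E_u)^k/k!$, expanding into monomials, reducing these by $\sigma_j^2=1$, and replacing every monomial expectation with its empirical value. The output is $\hat\theta_u=\frac1T\sum_{t=1}^T\theta^{(t)}$ for every $u$; its coordinate $v\ne u$ is the estimate $\hat\theta_{u,v}$. **Theorem.** 1. If $|\hat\theta_{u,v}-\theta^*_{u,v}|\le\alpha/2$ for all $u\neq v$, with strict inequality whenever $\theta^*_{u,v}=0$, then $\hat E=E$. 2. Let $\gamma$ satisfy $\sum_{v\ne u}|\theta^*_{u,v}|+|\theta^*_u|\le\gamma$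 for all $u$, let $0<\epsilon\le 4\gamma$ with $\epsilon\le\alpha/2$, and let $\delta>0$. Run the algorithm with $$d=\left\lceil\frac{3\gamma+\log\frac{16\gamma(1+\gamma)}{\epsilon^2}}{W\!\left(\frac3e+\frac{1}{\gamma e}\log\frac{16\gamma(1+\gamma)}{\epsilon^2}\right)}\right\rceil-1,\qquad T=\left\lceil\frac{576\,p\,\gamma^2e^{8\gamma}(1+\gamma)^2}{\epsilon^4}\right\rceil,\qquad \eta=\frac{2\gamma e^{-\gamma}}{3\sqrt{pT}},$$ $$n=\left\lceil 2^7e^{8\gamma}\gamma^2(1+\gamma)^2\,\frac{(d+2)\log(ep)+\log\frac{2p(d+2)}{\delta}}{\epsilon^4}\right\rceil,$$ where $W$ is the principal branch of the Lambert function. Then thresholding its output gives $\hat E=E$ with probability at least $1-\delta p$. -/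

import Mathlib

open MeasureTheory ProbabilityTheory
open scoped BigOperators

/-! ### The principal branch of the Lambert function -/

theorem lambert_exists (x : ℝ) (hx : -Real.exp (-1) ≤ x) :
    ∃ w : ℝ, -1 ≤ w ∧ w * Real.exp w = x := by
  have hcont : ContinuousOn (fun w : ℝ => w * Real.exp w) (Set.Icc (-1) (max x 0)) := by
    fun_prop
  have hle : (-1 : ℝ) ≤ max x 0 := le_trans (by norm_num) (le_max_right x 0)
  have himg := intermediate_value_Icc hle hcont
  have hmem : x ∈ Set.Icc ((-1 : ℝ) * Real.exp (-1)) (max x 0 * Real.exp (max x 0)) := by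
    refine ⟨by linarith, ?_⟩
    have h0 : 0 ≤ max x 0 := le_max_right x 0
    have h1 : 1 ≤ Real.exp (max x 0) := Real.one_le_exp h0
    calc x ≤ max x 0 := le_max_left x 0
      _ ≤ max x 0 * Real.exp (max x 0) := le_mul_of_one_le_right h0 h1
  obtain ⟨w, hw, hwx⟩ := himg hmem
  exact ⟨w, hw.1, hwx⟩

open Classical in
/-- The principal branch `W` of the Lambert function: for `x ≥ -1/e`, the solution `w ≥ -1` of
`w e ^ w = x` (it is unique, since `w ↦ w e ^ w` is strictly increasing on `[-1, ∞)`).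
The value is `0` for `x < -1/e`. -/
noncomputable def lambertW (x : ℝ) : ℝ :=
  if hx : -Real.exp (-1) ≤ x then (lambert_exists x hx).choose else 0

theorem lambertW_spec {x : ℝ} (hx : -Real.exp (-1) ≤ x) :
    -1 ≤ lambertW x ∧ lambertW x * Real.exp (lambertW x) = x := by
  unfold lambertW
  rw [dif_pos hx]
  exact (lambert_exists x hx).choose_spec

/-! ### Ising models -/

/-- Spin configurations `σ ∈ {-1, 1} ^ p`. -/
abbrev SpinConfig (p : ℕ) : Type := Fin p → ℤˣ

/-- The spin at `u`, as a real number `1` or `-1`. -/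
def spin {p : ℕ} (σ : SpinConfig p) (u : Fin p) : ℝ := ((σ u : ℤ) : ℝ)

/-- The parameters of an Ising model on `p` spins: one coupling for each unordered pair of distinct
sites, stored as a symmetric array whose diagonal is never used, and one magnetic field for each
site. -/
structure IsingModel (p : ℕ) where
  coupling : Fin p → Fin p → ℝ
  field : Fin p → ℝ
  symm : ∀ u v, coupling u v = coupling v u

namespace IsingModel

variable {p : ℕ} (M : IsingModel p)

/-- `E(σ) = ∑ θ*_{u,v} σ_u σ_v + ∑ θ*_u σ_u`, the first sum over unordered pairs of distinct
sites. -/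
noncomputable def energy (σ : SpinConfig p) : ℝ :=
  (∑ e ∈ Finset.univ.filter (fun e : Fin p × Fin p => e.1 < e.2),
      M.coupling e.1 e.2 * spin σ e.1 * spin σ e.2)
    + ∑ u, M.field u * spin σ u

/-- The Gibbs probability of a configuration, proportional to `exp (E(σ))`. -/
noncomputable def gibbsProb (σ : SpinConfig p) : ℝ :=
  Real.exp (M.energy σ) / ∑ τ : SpinConfig p, Real.exp (M.energy τ)

/-- The Gibbs distribution of the model. -/
noncomputable def gibbsMeasure : Measure (SpinConfig p) :=
  ∑ σ : SpinConfig p, ENNReal.ofReal (M.gibbsProb σ) • Measure.dirac σ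

/-- `γ` bounds the `ℓ₁`-width: `∑_{v ≠ u} |θ*_{u,v}| + |θ*_u| ≤ γ` for every `u`. -/
def HasWidthLE (γ : ℝ) : Prop :=
  ∀ u, (∑ v ∈ Finset.univ.erase u, |M.coupling u v|) + |M.field u| ≤ γ

/-- The edge set `E`: the pairs of distinct sites with a nonzero coupling. -/
def edges : Set (Fin p × Fin p) :=
  {e | e.1 ≠ e.2 ∧ M.coupling e.1 e.2 ≠ 0}

end IsingModel

/-- The thresholded edge set: the pairs of distinct sites whose estimated coupling has absolute
value at least `α / 2`. -/
def thresholdEdges {p : ℕ} (α : ℝ) (θhat : Fin p → Fin p → ℝ) : Set (Fin p × Fin p) :=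
  {e | e.1 ≠ e.2 ∧ α / 2 ≤ |θhat e.1 e.2|}

/-! ### Reduced statistics -/

/-- The index sets `K ⊆ [p]` of the monomials of degree at most `D`. -/
abbrev MonomialIndex (p D : ℕ) : Type := {K : Finset (Fin p) // K.card ≤ D}

/-- A table of values, one for each monomial `∏_{u ∈ K} σ_u` of degree at most `D`. -/
abbrev Statistics (p D : ℕ) : Type := MonomialIndex p D → ℝ

/-- The empirical statistics `E_n[∏_{u ∈ K} σ_u]`, `|K| ≤ D`, where each `K` may come with its own
list of `n` samples. -/
noncomputable def empiricalStatistics {p D n : ℕ}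
    (x : MonomialIndex p D → Fin n → SpinConfig p) : Statistics p D :=
  fun K => (∑ t, ∏ u ∈ K.1, spin (x K t) u) / n

/-! ### Interaction screening with moment-based approximate gradients

A local parameter vector at the site `u` is a vector indexed by `Fin p` whose coordinate `u` is the
magnetic field `θ_u`, and whose coordinate `v ≠ u` is the coupling `θ_{u,v}`. -/

/-- The set of sites with an odd exponent; as spins square to `1`, the monomial `∏_j σ_j ^ (e j)`
equals `∏_{j ∈ oddSites e} σ_j`. -/
def oddSites {p : ℕ} (e : Fin p → ℕ) : Finset (Fin p) :=
  Finset.univ.filter (fun j => Odd (e j))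

/-- The exponents of the monomials in the expansion of the `w`-th partial derivative:
`σ_w σ_u ^ (k + 1) ∏_{j ≠ u} σ_j ^ (m j)` for a coupling (`w ≠ u`), and
`σ_u ^ (k + 1) ∏_{j ≠ u} σ_j ^ (m j)` for the magnetic field (`w = u`). -/
def gradExponent {p : ℕ} (u w : Fin p) (k : ℕ) (m : Fin p → ℕ) (j : Fin p) : ℕ :=
  (if j = w ∧ w ≠ u then 1 else 0) + (if j = u then k + 1 else m j)

/-- The tabulated value of the monomial with exponents `e`. The default value is never used in the
algorithm, see `oddSites_gradExponent_card_le`. -/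
noncomputable def Statistics.eval {p D : ℕ} (S : Statistics p D) (e : Fin p → ℕ) : ℝ :=
  if h : (oddSites e).card ≤ D then S ⟨oddSites e, h⟩ else 0

/-- The degree `d + 2 - (d mod 2)` of the statistics used with a degree-`d` approximation. -/
def statDegree (d : ℕ) : ℕ := d + 2 - d % 2

theorem oddSites_gradExponent_card_le {p d k : ℕ} (u w : Fin p) (m : Fin p → ℕ)
    (hk : k ≤ d) (hm : ∑ j, m j = k) :
    (oddSites (gradExponent u w k m)).card ≤ statDegree d := by
  have hsub : oddSites (gradExponent u w k m) ⊆
      ({w} ∪ (if Odd (k + 1) then {u} else ∅)) ∪ Finset.univ.filter (fun j => 1 ≤ m j) := by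
    intro j hj
    have hj := (Finset.mem_filter.mp hj).2
    unfold gradExponent at hj
    simp only [Finset.mem_union, Finset.mem_singleton, Finset.mem_filter, Finset.mem_univ,
      true_and]
    by_cases hw : j = w
    · exact Or.inl (Or.inl hw)
    · by_cases hu : j = u
      · rw [if_neg (fun h => hw h.1), zero_add, if_pos hu] at hj
        left; right
        simp [hj, hu]
      · rw [if_neg (fun h => hw h.1), zero_add, if_neg hu] at hj
        right
        exact hj.pos
  have hcard : (Finset.univ.filter (fun j => 1 ≤ m j)).card ≤ k := by
    rw [← hm, Finset.card_eq_sum_ones, Finset.sum_filter]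
    refine Finset.sum_le_sum fun j _ => ?_
    split_ifs <;> omega
  have h1 := Finset.card_le_card hsub
  have h2 := Finset.card_union_le ({w} ∪ (if Odd (k + 1) then {u} else ∅))
    (Finset.univ.filter (fun j => 1 ≤ m j))
  have h3 := Finset.card_union_le ({w} : Finset (Fin p)) (if Odd (k + 1) then {u} else ∅)
  unfold statDegree
  by_cases hodd : Odd (k + 1)
  · simp only [hodd, if_true, Finset.card_singleton] at h1 h2 h3
    rw [Nat.odd_iff] at hodd
    omega
  · simp only [hodd, if_false, Finset.card_singleton, Finset.card_empty] at h1 h2 h3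
    omega

/-- The multinomial coefficient `C_{θ,m} = k! θ_u ^ (m u) ∏_{j ≠ u} θ_{u,j} ^ (m j) / ∏_j (m j)!`. -/
noncomputable def multinomialCoeff {p : ℕ} (θ : EuclideanSpace ℝ (Fin p)) (k : ℕ)
    (m : Fin p → ℕ) : ℝ :=
  (k.factorial : ℝ) * (∏ j, θ j ^ m j) / ∏ j, ((m j).factorial : ℝ)

/-- The approximate gradient of the interaction screening loss at the site `u`: in the exact
gradient, with components `-E[σ_u σ_w e ^ (-E_u)]` (`w ≠ u`) and `-E[σ_u e ^ (-E_u)]` (`w = u`), the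
exponential is replaced by its Taylor polynomial of degree `d`, the powers of
`∑_{j ≠ u} θ_{u,j} σ_j + θ_u` are expanded, and every monomial expectation is replaced by its value
in the table `S`. -/
noncomputable def approxGradient {p D : ℕ} (d : ℕ) (S : Statistics p D) (u : Fin p)
    (θ : EuclideanSpace ℝ (Fin p)) : EuclideanSpace ℝ (Fin p) :=
  WithLp.toLp 2 fun w =>
    -∑ k ∈ Finset.range (d + 1), (-1 : ℝ) ^ k / (k.factorial : ℝ) *
      ∑ m ∈ Finset.piAntidiag (Finset.univ : Finset (Fin p)) k,
        multinomialCoeff θ k m * S.eval (gradExponent u w k m)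

/-- The `ℓ₁` ball of radius `γ` in `ℝ ^ p`. -/
def l1Ball (p : ℕ) (γ : ℝ) : Set (EuclideanSpace ℝ (Fin p)) :=
  {x | ∑ j, |x j| ≤ γ}

theorem exists_l1Projection {p : ℕ} {γ : ℝ} (hγ : 0 ≤ γ) (z : EuclideanSpace ℝ (Fin p)) :
    ∃ x ∈ l1Ball p γ, ∀ y ∈ l1Ball p γ, ‖z - x‖ ≤ ‖z - y‖ := by
  have hclosed : IsClosed (l1Ball p γ) := by
    unfold l1Ball
    exact isClosed_le (by fun_prop) continuous_const
  have hne : (l1Ball p γ).Nonempty := ⟨0, by simpa [l1Ball] using hγ⟩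
  obtain ⟨x, hx, hxz⟩ := hclosed.exists_infDist_eq_dist hne z
  refine ⟨x, hx, fun y hy => ?_⟩
  rw [← dist_eq_norm, ← dist_eq_norm, ← hxz]
  exact Metric.infDist_le_dist_of_mem hy

open Classical in
/-- The Euclidean projection onto the `ℓ₁` ball of radius `γ ≥ 0`: the point of the ball that is
nearest to `z` in the Euclidean norm (unique, as the ball is convex). -/
noncomputable def l1Projection {p : ℕ} (γ : ℝ) (z : EuclideanSpace ℝ (Fin p)) :
    EuclideanSpace ℝ (Fin p) :=
  if hγ : 0 ≤ γ then (exists_l1Projection hγ z).choose else 0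

theorem l1Projection_spec {p : ℕ} {γ : ℝ} (hγ : 0 ≤ γ) (z : EuclideanSpace ℝ (Fin p)) :
    l1Projection γ z ∈ l1Ball p γ ∧ ∀ y ∈ l1Ball p γ, ‖z - l1Projection γ z‖ ≤ ‖z - y‖ := by
  unfold l1Projection
  rw [dif_pos hγ]
  exact (exists_l1Projection hγ z).choose_spec

/-- The iterates of projected gradient descent at the site `u`; `screeningIterate _ _ _ _ _ t` is
the iterate with number `t + 1`, and the first iterate is `0`. -/
noncomputable def screeningIterate {p D : ℕ} (d : ℕ) (S : Statistics p D) (γ η : ℝ) (u : Fin p) :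
    ℕ → EuclideanSpace ℝ (Fin p)
  | 0 => 0
  | t + 1 =>
    l1Projection γ (screeningIterate d S γ η u t
      - η • approxGradient d S u (screeningIterate d S γ η u t))

/-- The output of the algorithm: for every site `u`, the average of the first `T` iterates. The
entry `(u, v)` with `v ≠ u` is the estimate of the coupling `θ*_{u,v}` (and the entry `(u, u)` is
the coordinate of the magnetic field). The input is the degree `d`, the table of statistics of
degree at most `d + 2 - (d mod 2)`, the bound `γ`, the step size `η`, and the number `T` of
iterations. -/
noncomputable def screeningAlgorithm {p : ℕ} (d : ℕ) (S : Statistics p (statDegree d)) (γ η : ℝ)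
    (T : ℕ) (u v : Fin p) : ℝ :=
  ((T : ℝ)⁻¹ • ∑ t ∈ Finset.range T, screeningIterate d S γ η u t) v

/-! ### The parameters of the algorithm -/

/-- `d = ⌈(3γ + ℓ) / W(3/e + ℓ/(γe))⌉ - 1` with `ℓ = log (16γ(1+γ)/ε²)`. -/
noncomputable def screeningDegree (γ ε : ℝ) : ℕ :=
  ⌈(3 * γ + Real.log (16 * γ * (1 + γ) / ε ^ 2)) /
      lambertW (3 / Real.exp 1 + Real.log (16 * γ * (1 + γ) / ε ^ 2) / (γ * Real.exp 1))⌉₊ - 1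

/-- `T = ⌈576 p γ² e^{8γ} (1+γ)² / ε⁴⌉`. -/
noncomputable def screeningIterations (p : ℕ) (γ ε : ℝ) : ℕ :=
  ⌈576 * p * γ ^ 2 * Real.exp (8 * γ) * (1 + γ) ^ 2 / ε ^ 4⌉₊

/-- `η = 2 γ e^{-γ} / (3 √(pT))`. -/
noncomputable def screeningStepSize (p : ℕ) (γ ε : ℝ) : ℝ :=
  2 * γ * Real.exp (-γ) / (3 * Real.sqrt (p * screeningIterations p γ ε))

/-- `n = ⌈2⁷ e^{8γ} γ² (1+γ)² ((d+2) log(ep) + log(2p(d+2)/δ)) / ε⁴⌉`. -/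
noncomputable def screeningSampleSize (p : ℕ) (γ ε δ : ℝ) : ℕ :=
  ⌈2 ^ 7 * Real.exp (8 * γ) * γ ^ 2 * (1 + γ) ^ 2 *
      (((screeningDegree γ ε : ℝ) + 2) * Real.log (Real.exp 1 * p) +
        Real.log (2 * p * ((screeningDegree γ ε : ℝ) + 2) / δ)) / ε ^ 4⌉₊

/-! Thresholding is elementary: a true coupling is either zero or at least `α` in size, so an error
below `α / 2` cannot cross the threshold. What has to be shown is that the averaged iterates have
coordinate error below `ε`.

The loss `E[e ^ (-E_u)]` is convex and its gradient vanishes at the true parameters, because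
flipping `σ_u` leaves `μ(σ) e ^ (-E_u)` unchanged and negates the remaining factor
(`expect_screening_eq_zero`). The pointwise bound `sq_div_le_exp_neg_sub`, together with a
second-moment bound obtained by flipping `σ_v`, makes the excess loss at least a constant times the
squared error in coordinate `v` (`mul_sq_le_screeningLoss_sub`).

Convexity bounds the excess loss of each iterate by the inner product of the exact gradient with the
displacement from the truth. Replacing the exact gradient by the approximate one costs its sup-norm
error times an `ℓ₁` distance of at most `2γ`. The remaining inner products are summed by the regret
bound for projected descent, which holds for arbitrary gradient vectors. Cauchy–Schwarz then passes
from the mean squared error of the iterates to the error of their mean.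

The gradient error has two sources. The Taylor tail is controlled by Stirling's bound and the
Lambert-function choice of `d`; the sampling error is at most `e ^ γ` times the worst error in the
table of moments. Hoeffding's inequality and a union bound over the table control the latter, for
any joint law of the samples used for different monomials. -/

/-! ### Spins and single-site flips -/

section Spins

variable {p : ℕ}

theorem spin_mul_self (σ : SpinConfig p) (u : Fin p) : spin σ u * spin σ u = 1 := by
  unfold spin
  rcases Int.units_eq_one_or (σ u) with h | h <;> simp [h]

theorem spin_sq (σ : SpinConfig p) (u : Fin p) : spin σ u ^ 2 = 1 := by
  rw [sq, spin_mul_self]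

theorem abs_spin (σ : SpinConfig p) (u : Fin p) : |spin σ u| = 1 := by
  unfold spin
  rcases Int.units_eq_one_or (σ u) with h | h <;> simp [h]

/-- The configuration `σ` with the spin at `u` reversed. -/
def flipAt (u : Fin p) (σ : SpinConfig p) : SpinConfig p := Function.update σ u (-σ u)

theorem flipAt_involutive (u : Fin p) : Function.Involutive (flipAt u) := by
  intro σ
  simp [flipAt]

theorem spin_flipAt_self (u : Fin p) (σ : SpinConfig p) :
    spin (flipAt u σ) u = -spin σ u := by
  simp [spin, flipAt]

theorem spin_flipAt_of_ne {u v : Fin p} (h : v ≠ u) (σ : SpinConfig p) :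
    spin (flipAt u σ) v = spin σ v := by
  simp [spin, flipAt, h]

theorem spin_flipAt (u v : Fin p) (σ : SpinConfig p) :
    spin (flipAt u σ) v = spin σ v - (if v = u then 2 * spin σ v else 0) := by
  by_cases h : v = u
  · subst h; rw [spin_flipAt_self, if_pos rfl]; ring
  · rw [spin_flipAt_of_ne h, if_neg h, sub_zero]

theorem sum_flipAt (u : Fin p) (f : SpinConfig p → ℝ) :
    ∑ σ, f (flipAt u σ) = ∑ σ, f σ :=
  Equiv.sum_comp (flipAt_involutive u).toPerm f

/-- The coefficient with which the `w`-th local parameter at `u` enters the local field. -/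
def localFeature (u : Fin p) (σ : SpinConfig p) (w : Fin p) : ℝ :=
  if w = u then 1 else spin σ w

theorem abs_localFeature (u : Fin p) (σ : SpinConfig p) (w : Fin p) :
    |localFeature u σ w| = 1 := by
  unfold localFeature
  split_ifs
  · exact abs_one
  · exact abs_spin σ w

theorem localFeature_flipAt (u : Fin p) (σ : SpinConfig p) :
    localFeature u (flipAt u σ) = localFeature u σ := by
  funext w
  unfold localFeature
  split_ifs with h
  · rfl
  · exact spin_flipAt_of_ne h σ

/-- The linear form `θ_u + ∑_{j ≠ u} θ_{u,j} σ_j`. -/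
def localForm (u : Fin p) (θ : Fin p → ℝ) (σ : SpinConfig p) : ℝ :=
  ∑ w, θ w * localFeature u σ w

theorem localForm_flipAt (u : Fin p) (θ : Fin p → ℝ) (σ : SpinConfig p) :
    localForm u θ (flipAt u σ) = localForm u θ σ := by
  unfold localForm
  rw [localFeature_flipAt]

theorem localForm_sub (u : Fin p) (θ θ' : Fin p → ℝ) (σ : SpinConfig p) :
    localForm u (fun w => θ w - θ' w) σ = localForm u θ σ - localForm u θ' σ := by
  simp only [localForm, sub_mul, Finset.sum_sub_distrib]

theorem abs_localForm_le (u : Fin p) (θ : Fin p → ℝ) (σ : SpinConfig p) :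
    |localForm u θ σ| ≤ ∑ w, |θ w| := by
  refine (Finset.abs_sum_le_sum_abs _ _).trans (le_of_eq ?_)
  refine Finset.sum_congr rfl fun w _ => ?_
  rw [abs_mul, abs_localFeature, mul_one]

theorem abs_spin_mul_localForm_le {γ : ℝ} (u : Fin p) {θ : Fin p → ℝ} (h : ∑ w, |θ w| ≤ γ)
    (σ : SpinConfig p) : |spin σ u * localForm u θ σ| ≤ γ := by
  rw [abs_mul, abs_spin, one_mul]
  exact (abs_localForm_le u θ σ).trans h

/-- Flipping a neighbouring spin shifts the form by an amount governed by `θ v` alone; this is what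
isolates a single coordinate in the second-moment bound. -/
theorem localForm_flipAt_of_ne {u v : Fin p} (h : v ≠ u) (θ : Fin p → ℝ) (σ : SpinConfig p) :
    localForm u θ (flipAt v σ) = localForm u θ σ - 2 * θ v * spin σ v := by
  have : ∀ w, θ w * localFeature u (flipAt v σ) w =
      θ w * localFeature u σ w - if w = v then 2 * θ v * spin σ v else 0 := by
    intro w
    by_cases hw : w = v
    · subst hw
      simp only [localFeature, if_neg h, spin_flipAt_self, if_true]
      ring
    · simp only [localFeature, if_neg hw, spin_flipAt_of_ne hw, sub_zero]
  simp only [localForm, this, Finset.sum_sub_distrib, Finset.sum_ite_eq', Finset.mem_univ,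
    if_true]

end Spins

/-! ### The Gibbs distribution -/

namespace IsingModel

variable {p : ℕ} (M : IsingModel p)

/-- The true local parameters at `u`: the field in coordinate `u`, couplings elsewhere. -/
def localParams (u w : Fin p) : ℝ :=
  if w = u then M.field u else M.coupling u w

theorem sum_abs_localParams_le {γ : ℝ} (hγ : M.HasWidthLE γ) (u : Fin p) :
    ∑ w, |M.localParams u w| ≤ γ := by
  refine le_trans (le_of_eq ?_) (hγ u)
  rw [← Finset.sum_erase_add _ _ (Finset.mem_univ u)]
  congr 1
  · refine Finset.sum_congr rfl fun w hw => ?_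
    rw [localParams, if_neg (Finset.ne_of_mem_erase hw)]
  · rw [localParams, if_pos rfl]

/-- Only the terms containing `σ_u` change sign, and together they form `σ_u` times the local form
at the true parameters. -/
theorem energy_flipAt (u : Fin p) (σ : SpinConfig p) :
    M.energy (flipAt u σ) =
      M.energy σ - 2 * (spin σ u * localForm u (M.localParams u) σ) := by
  have hfield : ∑ v, M.field v * spin (flipAt u σ) v =
      ∑ v, M.field v * spin σ v - 2 * M.field u * spin σ u := by
    have : ∀ v, M.field v * spin (flipAt u σ) v =
        M.field v * spin σ v - if v = u then 2 * M.field u * spin σ u else 0 := by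
      intro v
      rw [spin_flipAt]
      split_ifs with h
      · subst h; ring
      · ring
    simp only [this, Finset.sum_sub_distrib, Finset.sum_ite_eq', Finset.mem_univ, if_true]
  have hpair : ∑ e ∈ Finset.univ.filter (fun e : Fin p × Fin p => e.1 < e.2),
        M.coupling e.1 e.2 * spin (flipAt u σ) e.1 * spin (flipAt u σ) e.2 =
      (∑ e ∈ Finset.univ.filter (fun e : Fin p × Fin p => e.1 < e.2),
        M.coupling e.1 e.2 * spin σ e.1 * spin σ e.2) -
      2 * ∑ w, if w = u then 0 else M.coupling u w * spin σ u * spin σ w := by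
    -- A pair with `a < b` loses twice its own term when one end is `u`. The two corrections never
    -- overlap, since `a < b` excludes `a = b = u`; the case `b = u` uses the symmetry of the
    -- couplings.
    have hterm : ∀ a b : Fin p,
        (if a < b then M.coupling a b * spin (flipAt u σ) a * spin (flipAt u σ) b else 0) =
        (if a < b then M.coupling a b * spin σ a * spin σ b else 0) -
        (if a = u then 2 * (if u < b then M.coupling u b * spin σ u * spin σ b else 0) else 0) -
        (if b = u then 2 * (if a < u then M.coupling u a * spin σ u * spin σ a else 0) else 0) := by
      intro a b
      rw [spin_flipAt, spin_flipAt]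
      by_cases hab : a < b
      · by_cases ha : a = u
        · subst ha
          have hb : b ≠ a := hab.ne'
          simp [hab, hb]; ring
        · by_cases hb : b = u
          · subst hb
            simp [hab, ha, M.symm b a]; ring
          · simp [hab, ha, hb]
      · by_cases ha : a = u
        · subst ha
          by_cases hb : b = a
          · subst hb; simp
          · simp [hab, hb]
        · by_cases hb : b = u
          · subst hb; simp [hab, ha]
          · simp [hab, ha, hb]
    have hsplit : ∀ w : Fin p,
        (if w = u then 0 else M.coupling u w * spin σ u * spin σ w) =
        (if u < w then M.coupling u w * spin σ u * spin σ w else 0) +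
        (if w < u then M.coupling u w * spin σ u * spin σ w else 0) := by
      intro w
      rcases lt_trichotomy u w with h | h | h
      · simp [h, h.ne', h.not_gt]
      · simp [h]
      · simp [h, h.ne, h.not_gt]
    rw [Finset.sum_filter, Finset.sum_filter, Fintype.sum_prod_type, Fintype.sum_prod_type]
    simp only [hterm, hsplit, Finset.sum_sub_distrib, Finset.sum_add_distrib]
    rw [Finset.sum_comm (f := fun a b : Fin p => if a = u then
      2 * (if u < b then M.coupling u b * spin σ u * spin σ b else 0) else 0)]
    simp only [Finset.sum_ite_eq', Finset.mem_univ, if_true, mul_add, ← Finset.mul_sum]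
    ring
  have hform : spin σ u * localForm u (M.localParams u) σ =
      (∑ w, if w = u then 0 else M.coupling u w * spin σ u * spin σ w) +
        M.field u * spin σ u := by
    have : ∀ w, spin σ u * (M.localParams u w * localFeature u σ w) =
        (if w = u then 0 else M.coupling u w * spin σ u * spin σ w) +
          if w = u then M.field u * spin σ u else 0 := by
      intro w
      unfold localParams localFeature
      split_ifs <;> ring
    simp only [localForm, Finset.mul_sum, this, Finset.sum_add_distrib, Finset.sum_ite_eq',
      Finset.mem_univ, if_true]
  rw [hform, energy, energy, hpair, hfield]
  ring

theorem sum_exp_energy_pos : 0 < ∑ τ : SpinConfig p, Real.exp (M.energy τ) :=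
  Finset.sum_pos (fun _ _ => Real.exp_pos _) Finset.univ_nonempty

theorem gibbsProb_pos (σ : SpinConfig p) : 0 < M.gibbsProb σ :=
  div_pos (Real.exp_pos _) M.sum_exp_energy_pos

theorem sum_gibbsProb : ∑ σ, M.gibbsProb σ = 1 := by
  simp only [gibbsProb]
  rw [← Finset.sum_div, div_self M.sum_exp_energy_pos.ne']

theorem gibbsProb_flipAt (u : Fin p) (σ : SpinConfig p) :
    M.gibbsProb (flipAt u σ) =
      M.gibbsProb σ * Real.exp (-(2 * (spin σ u * localForm u (M.localParams u) σ))) := by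
  rw [gibbsProb, gibbsProb, energy_flipAt, sub_eq_add_neg, Real.exp_add]
  ring

theorem gibbsProb_flipAt_ge {γ : ℝ} (hγ : M.HasWidthLE γ) (u : Fin p) (σ : SpinConfig p) :
    Real.exp (-2 * γ) * M.gibbsProb σ ≤ M.gibbsProb (flipAt u σ) := by
  rw [gibbsProb_flipAt, mul_comm]
  have h := abs_le.mp (abs_spin_mul_localForm_le u (M.sum_abs_localParams_le hγ u) σ)
  exact mul_le_mul_of_nonneg_left (Real.exp_le_exp.mpr (by linarith)) (M.gibbsProb_pos σ).le

/-- The expectation of `f` under the Gibbs distribution. -/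
noncomputable def expect (f : SpinConfig p → ℝ) : ℝ := ∑ σ, M.gibbsProb σ * f σ

variable {M}

theorem expect_mono {f g : SpinConfig p → ℝ} (h : ∀ σ, f σ ≤ g σ) : M.expect f ≤ M.expect g :=
  Finset.sum_le_sum fun σ _ => mul_le_mul_of_nonneg_left (h σ) (M.gibbsProb_pos σ).le

theorem expect_add (f g : SpinConfig p → ℝ) :
    M.expect (fun σ => f σ + g σ) = M.expect f + M.expect g := by
  simp only [expect, mul_add, Finset.sum_add_distrib]

theorem expect_sub (f g : SpinConfig p → ℝ) :
    M.expect (fun σ => f σ - g σ) = M.expect f - M.expect g := by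
  simp only [expect, mul_sub, Finset.sum_sub_distrib]

theorem expect_const_mul (c : ℝ) (f : SpinConfig p → ℝ) :
    M.expect (fun σ => c * f σ) = c * M.expect f := by
  simp only [expect, Finset.mul_sum]
  exact Finset.sum_congr rfl fun σ _ => by ring

theorem expect_const (c : ℝ) : M.expect (fun _ => c) = c := by
  simp only [expect, ← Finset.sum_mul, sum_gibbsProb, one_mul]

theorem expect_sum {ι : Type*} (s : Finset ι) (f : ι → SpinConfig p → ℝ) :
    M.expect (fun σ => ∑ i ∈ s, f i σ) = ∑ i ∈ s, M.expect (f i) := by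
  simp only [expect, Finset.mul_sum]
  exact Finset.sum_comm

theorem abs_expect_le {f : SpinConfig p → ℝ} {C : ℝ} (h : ∀ σ, |f σ| ≤ C) :
    |M.expect f| ≤ C := by
  rw [abs_le]
  constructor
  · rw [← expect_const (M := M) (-C)]
    exact expect_mono fun σ => (abs_le.mp (h σ)).1
  · rw [← expect_const (M := M) C]
    exact expect_mono fun σ => (abs_le.mp (h σ)).2

/-- Every local variance is at least `e ^ (-2γ)`. -/
theorem exp_mul_sq_le_expect_localForm_sq {γ : ℝ} (hγ : M.HasWidthLE γ) {u v : Fin p}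
    (huv : v ≠ u) (θ : Fin p → ℝ) :
    Real.exp (-2 * γ) * θ v ^ 2 ≤ M.expect (fun σ => localForm u θ σ ^ 2) := by
  have hγ0 : 0 ≤ γ :=
    (Finset.sum_nonneg fun w _ => abs_nonneg _).trans (M.sum_abs_localParams_le hγ u)
  have he : Real.exp (-2 * γ) ≤ 1 := Real.exp_le_one_iff.mpr (by linarith)
  -- A configuration and its flip at `v` have comparable weights, so the Gibbs law dominates `e ^
  -- (-2γ)` times its symmetrization under that flip.
  have hprob : ∀ σ, Real.exp (-2 * γ) * ((M.gibbsProb σ + M.gibbsProb (flipAt v σ)) / 2) ≤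
      M.gibbsProb σ := by
    intro σ
    have h1 := M.gibbsProb_flipAt_ge hγ v (flipAt v σ)
    rw [flipAt_involutive v σ] at h1
    have h2 := mul_le_mul_of_nonneg_right he (M.gibbsProb_pos σ).le
    linarith
  have hsymm : ∑ σ, M.gibbsProb (flipAt v σ) * localForm u θ σ ^ 2 =
      ∑ σ, M.gibbsProb σ * localForm u θ (flipAt v σ) ^ 2 := by
    rw [← sum_flipAt v]
    exact Finset.sum_congr rfl fun σ _ => by rw [flipAt_involutive v σ]
  calc Real.exp (-2 * γ) * θ v ^ 2
      = Real.exp (-2 * γ) * M.expect (fun _ => θ v ^ 2) := by rw [expect_const]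
    _ ≤ Real.exp (-2 * γ) * M.expect
        (fun σ => (localForm u θ σ ^ 2 + localForm u θ (flipAt v σ) ^ 2) / 2) := by
        refine mul_le_mul_of_nonneg_left (expect_mono fun σ => ?_) (Real.exp_pos _).le
        rw [localForm_flipAt_of_ne huv]
        have h := spin_sq σ v
        have h' : (θ v * spin σ v) ^ 2 = θ v ^ 2 := by rw [mul_pow, h, mul_one]
        -- With `a` the form and `b = θ v * spin σ v`, this is `a² + (a - 2b)² = 2(a - b)² + 2b² ≥
        -- 2b²`.
        nlinarith [sq_nonneg (localForm u θ σ - θ v * spin σ v)]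
    _ = ∑ σ, Real.exp (-2 * γ) * ((M.gibbsProb σ + M.gibbsProb (flipAt v σ)) / 2) *
          localForm u θ σ ^ 2 := by
        have h1 : ∀ σ, Real.exp (-2 * γ) * ((M.gibbsProb σ + M.gibbsProb (flipAt v σ)) / 2) *
            localForm u θ σ ^ 2 = Real.exp (-2 * γ) / 2 * (M.gibbsProb σ * localForm u θ σ ^ 2) +
            Real.exp (-2 * γ) / 2 * (M.gibbsProb (flipAt v σ) * localForm u θ σ ^ 2) :=
          fun σ => by ring
        simp only [h1, Finset.sum_add_distrib, ← Finset.mul_sum, hsymm]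
        simp only [expect, Finset.mul_sum, ← Finset.sum_add_distrib]
        exact Finset.sum_congr rfl fun σ _ => by ring
    _ ≤ M.expect (fun σ => localForm u θ σ ^ 2) :=
        Finset.sum_le_sum fun σ _ => mul_le_mul_of_nonneg_right (hprob σ) (sq_nonneg _)

end IsingModel

/-! ### The interaction screening loss -/

/-- For `z ≥ 0`, clearing the denominator leaves `(2 + z) e ^ (-z) + z ≥ 2`, an equality at `0`
whose left side is nondecreasing. For `z ≤ 0`, the quadratic lower bound on `e ^ (-z)` already gives
`z² / 2`. The denominator grows only linearly in `|z|`, so the curvature constant later costs `1 +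
γ` and not another exponential. -/
theorem sq_div_le_exp_neg_sub (z : ℝ) : z ^ 2 / (2 + |z|) ≤ Real.exp (-z) - 1 + z := by
  rcases le_total 0 z with hz | hz
  · rw [abs_of_nonneg hz, div_le_iff₀ (by linarith)]
    have hmono : MonotoneOn (fun x : ℝ => (2 + x) * Real.exp (-x) + x) (Set.Ici 0) := by
      have hd : ∀ x : ℝ, HasDerivAt (fun x : ℝ => (2 + x) * Real.exp (-x) + x)
          (1 - (1 + x) * Real.exp (-x)) x := by
        intro x
        have h := (((hasDerivAt_id x).const_add 2).mul ((hasDerivAt_id x).neg.exp)).add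
          (hasDerivAt_id x)
        refine h.congr_deriv ?_
        simp
        ring
      refine monotoneOn_of_deriv_nonneg (convex_Ici 0)
        (fun x _ => (hd x).continuousAt.continuousWithinAt)
        (fun x _ => (hd x).differentiableAt.differentiableWithinAt) fun x _ => ?_
      rw [(hd x).deriv]
      have h := mul_le_mul_of_nonneg_right (Real.add_one_le_exp x) (Real.exp_pos (-x)).le
      rw [← Real.exp_add, add_neg_cancel, Real.exp_zero] at h
      linarith
    have h := hmono (Set.mem_Ici.mpr le_rfl) (Set.mem_Ici.mpr hz) hz
    simp only [add_zero, neg_zero, Real.exp_zero, mul_one] at h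
    nlinarith
  · rw [abs_of_nonpos hz, div_le_iff₀ (by linarith)]
    have h := Real.quadratic_le_exp_of_nonneg (neg_nonneg.mpr hz)
    nlinarith [mul_nonneg (neg_nonneg.mpr hz) (sq_nonneg z)]

namespace IsingModel

variable {p : ℕ} (M : IsingModel p)

/-- The interaction screening loss `E[e ^ (-E_u)]`. -/
noncomputable def screeningLoss (u : Fin p) (θ : Fin p → ℝ) : ℝ :=
  M.expect fun σ => Real.exp (-(spin σ u * localForm u θ σ))

/-- The gradient of the interaction screening loss. -/
noncomputable def screeningGradient (u : Fin p) (θ : Fin p → ℝ) (w : Fin p) : ℝ :=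
  -M.expect fun σ => localFeature u σ w * spin σ u * Real.exp (-(spin σ u * localForm u θ σ))

theorem sum_screeningGradient_mul (u : Fin p) (θ Δ : Fin p → ℝ) :
    ∑ w, M.screeningGradient u θ w * Δ w =
      -M.expect fun σ => spin σ u * localForm u Δ σ *
        Real.exp (-(spin σ u * localForm u θ σ)) := by
  simp only [screeningGradient, neg_mul, Finset.sum_neg_distrib, neg_inj]
  have h : ∀ w, (M.expect fun σ => localFeature u σ w * spin σ u *
      Real.exp (-(spin σ u * localForm u θ σ))) * Δ w = M.expect fun σ => Δ w *
        (localFeature u σ w * spin σ u * Real.exp (-(spin σ u * localForm u θ σ))) := by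
    intro w
    rw [expect_const_mul, mul_comm]
  simp only [h, ← expect_sum]
  congr 1
  funext σ
  simp only [localForm, Finset.mul_sum, Finset.sum_mul]
  exact Finset.sum_congr rfl fun w _ => by ring

/-- First-order convexity, taken pointwise: multiply `1 + (x - y) ≤ e ^ (x - y)` by `e ^ (-x)`. -/
theorem screeningLoss_sub_le (u : Fin p) (θ θ' : Fin p → ℝ) :
    M.screeningLoss u θ - M.screeningLoss u θ' ≤
      ∑ w, M.screeningGradient u θ w * (θ w - θ' w) := by
  rw [sum_screeningGradient_mul, screeningLoss, screeningLoss, ← expect_sub, neg_eq_neg_one_mul,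
    ← expect_const_mul]
  refine expect_mono fun σ => ?_
  rw [localForm_sub]
  have h := mul_le_mul_of_nonneg_left
    (Real.add_one_le_exp (spin σ u * localForm u θ σ - spin σ u * localForm u θ' σ))
    (Real.exp_pos (-(spin σ u * localForm u θ σ))).le
  rw [← Real.exp_add, show -(spin σ u * localForm u θ σ) + (spin σ u * localForm u θ σ -
    spin σ u * localForm u θ' σ) = -(spin σ u * localForm u θ' σ) by ring] at h
  linarith

/-- The gradient of the loss vanishes at the true parameters. -/
theorem expect_screening_eq_zero (u : Fin p) (Δ : Fin p → ℝ) :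
    (M.expect fun σ => spin σ u * localForm u Δ σ *
      Real.exp (-(spin σ u * localForm u (M.localParams u) σ))) = 0 := by
  have h : (M.expect fun σ => spin σ u * localForm u Δ σ *
      Real.exp (-(spin σ u * localForm u (M.localParams u) σ))) =
      -M.expect fun σ => spin σ u * localForm u Δ σ *
        Real.exp (-(spin σ u * localForm u (M.localParams u) σ)) := by
    conv_lhs => rw [expect, ← sum_flipAt u]
    rw [expect, ← Finset.sum_neg_distrib]
    refine Finset.sum_congr rfl fun σ _ => ?_
    -- The weight gains `e ^ (-2x)` and the exponential turns from `e ^ (-x)` into `e ^ x`, so their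
    -- product is invariant, while the factor `spin σ u` changes sign.
    rw [gibbsProb_flipAt, spin_flipAt_self, localForm_flipAt, localForm_flipAt]
    set x := spin σ u * localForm u (M.localParams u) σ with hx
    have : Real.exp (-(2 * x)) * Real.exp (-(-spin σ u * localForm u (M.localParams u) σ)) =
        Real.exp (-x) := by
      rw [← Real.exp_add]
      congr 1
      rw [hx]; ring
    calc _ = M.gibbsProb σ * (-spin σ u * localForm u Δ σ) * (Real.exp (-(2 * x)) *
          Real.exp (-(-spin σ u * localForm u (M.localParams u) σ))) := by ring
      _ = _ := by rw [this]; ring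
  linarith

/-- Restricted strong convexity of the loss around the true parameters. -/
theorem mul_sq_le_screeningLoss_sub {γ : ℝ} (hγ : M.HasWidthLE γ) {u v : Fin p} (huv : v ≠ u)
    {θ : Fin p → ℝ} (hθ : ∑ w, |θ w| ≤ γ) :
    Real.exp (-3 * γ) / (2 * (1 + γ)) * (θ v - M.localParams u v) ^ 2 ≤
      M.screeningLoss u θ - M.screeningLoss u (M.localParams u) := by
  have hγ0 : 0 ≤ γ := (Finset.sum_nonneg fun w _ => abs_nonneg _).trans hθ
  set Δ : Fin p → ℝ := fun w => θ w - M.localParams u w with hΔ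
  have hvar := exp_mul_sq_le_expect_localForm_sq hγ huv Δ
  have hpt : ∀ σ, Real.exp (-γ) / (2 * (1 + γ)) * localForm u Δ σ ^ 2 ≤
      (Real.exp (-(spin σ u * localForm u θ σ)) -
        Real.exp (-(spin σ u * localForm u (M.localParams u) σ))) +
      spin σ u * localForm u Δ σ *
        Real.exp (-(spin σ u * localForm u (M.localParams u) σ)) := by
    intro σ
    have h1 := abs_le.mp (abs_spin_mul_localForm_le u hθ σ)
    have h2 := abs_le.mp (abs_spin_mul_localForm_le u (M.sum_abs_localParams_le hγ u) σ)
    rw [hΔ, localForm_sub]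
    set x := spin σ u * localForm u θ σ with hx
    set y := spin σ u * localForm u (M.localParams u) σ with hy
    have hz : spin σ u * (localForm u θ σ - localForm u (M.localParams u) σ) = x - y := by ring
    have hsq : (localForm u θ σ - localForm u (M.localParams u) σ) ^ 2 = (x - y) ^ 2 := by
      rw [← hz, mul_pow, spin_sq, one_mul]
    rw [hsq, hz]
    have habs : |x - y| ≤ 2 * γ := abs_le.mpr ⟨by linarith, by linarith⟩
    have h3 := sq_div_le_exp_neg_sub (x - y)
    have h4 : (x - y) ^ 2 / (2 * (1 + γ)) ≤ Real.exp (-(x - y)) - 1 + (x - y) :=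
      (div_le_div_of_nonneg_left (sq_nonneg _) (by positivity) (by linarith)).trans h3
    have h5 : Real.exp (-γ) ≤ Real.exp (-y) := Real.exp_le_exp.mpr (by linarith)
    have h6 : Real.exp (-y) * Real.exp (-(x - y)) = Real.exp (-x) := by
      rw [← Real.exp_add]; congr 1; ring
    have h7 : (0 : ℝ) ≤ (x - y) ^ 2 / (2 * (1 + γ)) := by positivity
    -- The first-order remainder of `e ^ (-x)` at `y` factors as `e ^ (-y)` times the remainder at
    -- `0` with increment `x - y`; the range `|x - y| ≤ 2γ` gives the denominator `2 + 2γ`.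
    calc _ = Real.exp (-γ) * ((x - y) ^ 2 / (2 * (1 + γ))) := by ring
      _ ≤ Real.exp (-y) * (Real.exp (-(x - y)) - 1 + (x - y)) :=
          mul_le_mul h5 h4 h7 (Real.exp_pos _).le
      _ = Real.exp (-y) * Real.exp (-(x - y)) - Real.exp (-y) + (x - y) * Real.exp (-y) := by ring
      _ = _ := by rw [h6]
  have hE := expect_mono (M := M) hpt
  rw [expect_const_mul, expect_add, expect_sub, expect_screening_eq_zero, add_zero] at hE
  refine le_trans ?_ hE
  have h3 : Real.exp (-3 * γ) = Real.exp (-γ) * Real.exp (-2 * γ) := by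
    rw [← Real.exp_add]; congr 1; ring
  calc _ = Real.exp (-γ) / (2 * (1 + γ)) * (Real.exp (-2 * γ) * Δ v ^ 2) := by
        rw [h3, hΔ]; ring
    _ ≤ _ := mul_le_mul_of_nonneg_left hvar (by positivity)

end IsingModel

/-! ### Projected gradient descent on the `ℓ₁` ball -/

section Descent

variable {p : ℕ} {γ : ℝ}

theorem convex_l1Ball (p : ℕ) (γ : ℝ) : Convex ℝ (l1Ball p γ) := by
  intro x hx y hy a b ha hb hab
  simp only [l1Ball, Set.mem_ofPred_eq] at hx hy ⊢
  calc ∑ j, |(a • x + b • y) j| ≤ ∑ j, (a * |x j| + b * |y j|) := by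
        refine Finset.sum_le_sum fun j _ => ?_
        simp only [PiLp.add_apply, PiLp.smul_apply, smul_eq_mul]
        refine (abs_add_le _ _).trans (le_of_eq ?_)
        rw [abs_mul, abs_mul, abs_of_nonneg ha, abs_of_nonneg hb]
    _ = a * ∑ j, |x j| + b * ∑ j, |y j| := by
        rw [Finset.sum_add_distrib, Finset.mul_sum, Finset.mul_sum]
    _ ≤ a * γ + b * γ := by gcongr
    _ = γ := by rw [← add_mul, hab, one_mul]

/-- The angle at the projection between `z` and any point of the convex ball is not acute, so
expanding `‖z - y‖²` around the projection only adds nonnegative terms. -/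
theorem norm_l1Projection_sub_le (hγ : 0 ≤ γ) (z : EuclideanSpace ℝ (Fin p))
    {y : EuclideanSpace ℝ (Fin p)} (hy : y ∈ l1Ball p γ) :
    ‖l1Projection γ z - y‖ ^ 2 ≤ ‖z - y‖ ^ 2 := by
  obtain ⟨hmem, hmin⟩ := l1Projection_spec hγ z
  have hinf : ‖z - l1Projection γ z‖ = ⨅ w : l1Ball p γ, ‖z - w‖ := by
    have : Nonempty (l1Ball p γ) := ⟨⟨_, hmem⟩⟩
    refine le_antisymm (le_ciInf fun w => hmin w w.2) ?_
    exact ciInf_le ⟨0, by rintro _ ⟨w, rfl⟩; exact norm_nonneg _⟩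
      (⟨_, hmem⟩ : l1Ball p γ)
  have h := (norm_eq_iInf_iff_real_inner_le_zero (convex_l1Ball p γ) hmem).mp hinf y hy
  have h2 : z - y = (z - l1Projection γ z) - (y - l1Projection γ z) := by abel
  rw [h2, norm_sub_sq_real (z - l1Projection γ z), norm_sub_rev (l1Projection γ z) y]
  nlinarith [sq_nonneg ‖z - l1Projection γ z‖]

theorem norm_sq_le_of_mem_l1Ball {y : EuclideanSpace ℝ (Fin p)} (hy : y ∈ l1Ball p γ) :
    ‖y‖ ^ 2 ≤ γ ^ 2 := by
  have hy' : ∑ j, |y j| ≤ γ := hy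
  have h0 : 0 ≤ ∑ j, |y j| := Finset.sum_nonneg fun j _ => abs_nonneg _
  rw [EuclideanSpace.real_norm_sq_eq]
  calc ∑ j, y j ^ 2 ≤ ∑ j, |y j| * ∑ i, |y i| := by
        refine Finset.sum_le_sum fun j hj => ?_
        rw [← sq_abs, sq]
        exact mul_le_mul_of_nonneg_left
          (Finset.single_le_sum (f := fun i => |y i|) (fun i _ => abs_nonneg _) hj) (abs_nonneg _)
    _ = (∑ j, |y j|) ^ 2 := by rw [← Finset.sum_mul, sq]
    _ ≤ γ ^ 2 := by gcongr

/-- The regret bound of projected gradient descent with arbitrary (inexact) gradients. -/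
theorem sum_inner_le_of_l1Projection {η G : ℝ} (hγ : 0 ≤ γ) (hη : 0 < η)
    {x g : ℕ → EuclideanSpace ℝ (Fin p)} (hx0 : x 0 = 0)
    (hx : ∀ t, x (t + 1) = l1Projection γ (x t - η • g t))
    {y : EuclideanSpace ℝ (Fin p)} (hy : y ∈ l1Ball p γ) (hG : ∀ t, ‖g t‖ ^ 2 ≤ G) (T : ℕ) :
    ∑ t ∈ Finset.range T, inner ℝ (g t) (x t - y) ≤ γ ^ 2 / (2 * η) + η * T * G / 2 := by
  -- The squared distance to `y` serves as a potential: one step lowers it by `2η` times the inner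
  -- product, up to `η² G`. It starts at `‖y‖² ≤ γ²`.
  have key : ∀ T : ℕ, 2 * η * ∑ t ∈ Finset.range T, inner ℝ (g t) (x t - y) + ‖x T - y‖ ^ 2 ≤
      γ ^ 2 + T * (η ^ 2 * G) := by
    intro T
    induction T with
    | zero =>
      simp only [Finset.range_zero, Finset.sum_empty, mul_zero, zero_add, Nat.cast_zero, zero_mul,
        add_zero, hx0, zero_sub, norm_neg]
      exact norm_sq_le_of_mem_l1Ball hy
    | succ T ih =>
      rw [Finset.sum_range_succ, hx T]
      have h1 := norm_l1Projection_sub_le hγ (x T - η • g T) hy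
      have h2 : x T - η • g T - y = (x T - y) - η • g T := by abel
      rw [h2, norm_sub_sq_real (x T - y), inner_smul_right, norm_smul, mul_pow, Real.norm_eq_abs, sq_abs,
        real_inner_comm] at h1
      have h3 := mul_le_mul_of_nonneg_left (hG T) (sq_nonneg η)
      push_cast
      linarith
  have h := key T
  have h' : ∑ t ∈ Finset.range T, inner ℝ (g t) (x t - y) ≤
      (γ ^ 2 + T * (η ^ 2 * G)) / (2 * η) := by
    rw [le_div_iff₀ (by positivity)]
    nlinarith [sq_nonneg ‖x T - y‖]
  refine h'.trans (le_of_eq ?_)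
  field_simp

end Descent

/-! ### The approximate gradient -/

section Gradient

variable {p : ℕ}

theorem sum_multinomial (a : Fin p → ℝ) (k : ℕ) :
    ∑ m ∈ Finset.piAntidiag (Finset.univ : Finset (Fin p)) k,
      (k.factorial : ℝ) * (∏ j, a j ^ m j) / ∏ j, ((m j).factorial : ℝ) = (∑ j, a j) ^ k := by
  rw [Finset.sum_pow_eq_sum_piAntidiag]
  refine Finset.sum_congr rfl fun m hm => ?_
  have hk : ∑ j, m j = k := (Finset.mem_piAntidiag.mp hm).1
  have h := Nat.multinomial_spec Finset.univ m
  rw [hk] at h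
  have h' : (∏ j, ((m j).factorial : ℝ)) * (Nat.multinomial Finset.univ m : ℝ) =
      (k.factorial : ℝ) := by exact_mod_cast h
  have hne : (∏ j, ((m j).factorial : ℝ)) ≠ 0 :=
    Finset.prod_ne_zero_iff.mpr fun j _ => by positivity
  rw [← h']
  field_simp

theorem sum_multinomialCoeff_mul (θ : EuclideanSpace ℝ (Fin p)) (y : Fin p → ℝ) (k : ℕ) :
    ∑ m ∈ Finset.piAntidiag (Finset.univ : Finset (Fin p)) k,
      multinomialCoeff θ k m * ∏ j, y j ^ m j = (∑ j, θ j * y j) ^ k := by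
  rw [← sum_multinomial]
  refine Finset.sum_congr rfl fun m _ => ?_
  simp only [multinomialCoeff, mul_pow, Finset.prod_mul_distrib]
  ring

/-- Absolute values turn the coefficients of `θ` into those of `|θ|`. Errors in the table are
therefore amplified by powers of the `ℓ₁` norm, with no dependence on the number of monomials. -/
theorem sum_abs_multinomialCoeff (θ : EuclideanSpace ℝ (Fin p)) (k : ℕ) :
    ∑ m ∈ Finset.piAntidiag (Finset.univ : Finset (Fin p)) k, |multinomialCoeff θ k m| =
      (∑ j, |θ j|) ^ k := by
  rw [← sum_multinomial]
  refine Finset.sum_congr rfl fun m _ => ?_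
  rw [multinomialCoeff, abs_div, abs_mul, Finset.abs_prod, Finset.abs_prod]
  simp only [abs_pow, Nat.abs_cast]

theorem prod_spin_pow (σ : SpinConfig p) (e : Fin p → ℕ) :
    ∏ j, spin σ j ^ e j = ∏ j ∈ oddSites e, spin σ j := by
  rw [oddSites, Finset.prod_filter]
  refine Finset.prod_congr rfl fun j _ => ?_
  split_ifs with h
  · obtain ⟨r, hr⟩ := h
    rw [hr, pow_add, pow_mul, spin_sq, one_pow, one_mul, pow_one]
  · obtain ⟨r, hr⟩ := Nat.not_odd_iff_even.mp h
    rw [hr, ← two_mul, pow_mul, spin_sq, one_pow]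

theorem prod_spin_pow_gradExponent (σ : SpinConfig p) (u w : Fin p) (k : ℕ) (m : Fin p → ℕ) :
    ∏ j, spin σ j ^ gradExponent u w k m j =
      localFeature u σ w * spin σ u ^ (k + 1) * ∏ j, localFeature u σ j ^ m j := by
  have h : ∀ j, spin σ j ^ gradExponent u w k m j =
      (if j = w then localFeature u σ w else 1) *
        ((if j = u then spin σ u ^ (k + 1) else 1) * localFeature u σ j ^ m j) := by
    intro j
    unfold gradExponent localFeature
    rw [pow_add]
    congr 1
    · by_cases hj : j = w
      · subst hj
        by_cases hu : j = u <;> simp [hu]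
      · simp [hj]
    · by_cases hu : j = u
      · subst hu; simp
      · simp [hu]
  simp only [h, Finset.prod_mul_distrib, Finset.prod_ite_eq', Finset.mem_univ, if_true]
  ring

/-- The approximate gradient depends on the table of statistics in a Lipschitz way. -/
theorem abs_approxGradient_sub_le {D d : ℕ} {S S' : Statistics p D} {τ γ : ℝ}
    (hS : ∀ K, |S K - S' K| ≤ τ) (hτ : 0 ≤ τ) (u w : Fin p) {θ : EuclideanSpace ℝ (Fin p)}
    (hθ : ∑ j, |θ j| ≤ γ) :
    |approxGradient d S u θ w - approxGradient d S' u θ w| ≤ τ * Real.exp γ := by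
  have h0 : 0 ≤ ∑ j, |θ j| := Finset.sum_nonneg fun j _ => abs_nonneg _
  have heval : ∀ e, |S.eval e - S'.eval e| ≤ τ := by
    intro e
    unfold Statistics.eval
    split_ifs
    · exact hS _
    · simpa using hτ
  have hrw : approxGradient d S u θ w - approxGradient d S' u θ w =
      -∑ k ∈ Finset.range (d + 1), (-1 : ℝ) ^ k / (k.factorial : ℝ) *
        ∑ m ∈ Finset.piAntidiag (Finset.univ : Finset (Fin p)) k, multinomialCoeff θ k m *
          (S.eval (gradExponent u w k m) - S'.eval (gradExponent u w k m)) := by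
    simp only [approxGradient, mul_sub, Finset.sum_sub_distrib]
    ring
  rw [hrw, abs_neg]
  calc _ ≤ ∑ k ∈ Finset.range (d + 1), τ * ((∑ j, |θ j|) ^ k / (k.factorial : ℝ)) := by
        refine (Finset.abs_sum_le_sum_abs _ _).trans (Finset.sum_le_sum fun k _ => ?_)
        rw [abs_mul, abs_div, abs_pow, abs_neg, abs_one, one_pow, Nat.abs_cast]
        have : |∑ m ∈ Finset.piAntidiag (Finset.univ : Finset (Fin p)) k, multinomialCoeff θ k m *
            (S.eval (gradExponent u w k m) - S'.eval (gradExponent u w k m))| ≤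
            (∑ j, |θ j|) ^ k * τ := by
          rw [← sum_abs_multinomialCoeff, Finset.sum_mul]
          refine (Finset.abs_sum_le_sum_abs _ _).trans (Finset.sum_le_sum fun m _ => ?_)
          rw [abs_mul]
          exact mul_le_mul_of_nonneg_left (heval _) (abs_nonneg _)
        calc _ ≤ 1 / (k.factorial : ℝ) * ((∑ j, |θ j|) ^ k * τ) :=
              mul_le_mul_of_nonneg_left this (by positivity)
          _ = _ := by ring
    _ = τ * ∑ k ∈ Finset.range (d + 1), (∑ j, |θ j|) ^ k / (k.factorial : ℝ) := by
        rw [Finset.mul_sum]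
    _ ≤ τ * Real.exp γ := by
        refine mul_le_mul_of_nonneg_left ?_ hτ
        exact (Real.sum_le_exp_of_nonneg h0 _).trans (Real.exp_le_exp.mpr hθ)

theorem abs_approxGradient_le {D d : ℕ} {S : Statistics p D} {γ : ℝ} (hS : ∀ K, |S K| ≤ 1)
    (u w : Fin p) {θ : EuclideanSpace ℝ (Fin p)} (hθ : ∑ j, |θ j| ≤ γ) :
    |approxGradient d S u θ w| ≤ Real.exp γ := by
  have h := abs_approxGradient_sub_le (d := d) (S := S) (S' := fun _ => 0) (τ := 1)
    (fun K => by simpa using hS K) zero_le_one u w hθ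
  have h0 : approxGradient d (fun _ => 0 : Statistics p D) u θ w = 0 := by
    simp [approxGradient, Statistics.eval]
  rwa [h0, sub_zero, one_mul] at h

/-- Past index `m ≥ 2γ` consecutive Taylor terms shrink at least by half, so the tail is at most
twice its first term. -/
theorem abs_exp_neg_sub_sum_le {x γ : ℝ} {m : ℕ} (hx : |x| ≤ γ) (hm : 2 * γ ≤ m) :
    |Real.exp (-x) - ∑ k ∈ Finset.range m, (-x) ^ k / (k.factorial : ℝ)| ≤
      2 * (γ ^ m / (m.factorial : ℝ)) := by
  have hx' : ‖((-x : ℝ) : ℂ)‖ = |x| := by rw [Complex.norm_real, Real.norm_eq_abs, abs_neg]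
  have h := Complex.exp_bound' (x := ((-x : ℝ) : ℂ)) (n := m) (by
    rw [hx', div_le_iff₀ (by positivity)]
    push_cast
    linarith)
  have h2 : Complex.exp ((-x : ℝ) : ℂ) - ∑ k ∈ Finset.range m,
      ((-x : ℝ) : ℂ) ^ k / (k.factorial : ℂ) =
      ((Real.exp (-x) - ∑ k ∈ Finset.range m, (-x) ^ k / (k.factorial : ℝ) : ℝ) : ℂ) := by
    push_cast
    rfl
  rw [h2, Complex.norm_real, Real.norm_eq_abs, hx'] at h
  refine h.trans ?_
  rw [mul_comm]
  gcongr

namespace IsingModel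

variable (M : IsingModel p)

/-- The table of the exact statistics of the model. -/
noncomputable def moments (D : ℕ) : Statistics p D :=
  fun K => M.expect fun σ => ∏ u ∈ K.1, spin σ u

/-- With exact moments the expansion can be undone: the only error left in the approximate gradient
is the truncation of the exponential. -/
theorem approxGradient_moments (d : ℕ) (u w : Fin p) (θ : EuclideanSpace ℝ (Fin p)) :
    approxGradient d (M.moments (statDegree d)) u θ w =
      -M.expect fun σ => localFeature u σ w * spin σ u *
        ∑ k ∈ Finset.range (d + 1), (-(spin σ u * localForm u θ σ)) ^ k / (k.factorial : ℝ) := by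
  have heval : ∀ k ∈ Finset.range (d + 1), ∀ m ∈ Finset.piAntidiag Finset.univ k,
      (M.moments (statDegree d)).eval (gradExponent u w k m) =
      M.expect fun σ => localFeature u σ w * spin σ u ^ (k + 1) *
        ∏ j, localFeature u σ j ^ m j := by
    intro k hk m hm
    have hcard := oddSites_gradExponent_card_le (d := d) u w m
      (Nat.lt_succ_iff.mp (Finset.mem_range.mp hk)) (Finset.mem_piAntidiag.mp hm).1
    rw [Statistics.eval, dif_pos hcard, moments]
    congr 1
    funext σ
    rw [← prod_spin_pow, prod_spin_pow_gradExponent]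
  simp only [approxGradient, neg_inj, Finset.mul_sum, expect_sum]
  refine Finset.sum_congr rfl fun k hk => ?_
  rw [← Finset.mul_sum, Finset.sum_congr rfl fun m hm => by rw [heval k hk m hm]]
  simp only [← expect_const_mul, ← expect_sum]
  congr 1
  funext σ
  have h := sum_multinomialCoeff_mul θ (localFeature u σ) k
  calc _ = (-1 : ℝ) ^ k / (k.factorial : ℝ) * (localFeature u σ w * spin σ u ^ (k + 1)) *
        ∑ m ∈ Finset.piAntidiag Finset.univ k,
          multinomialCoeff θ k m * ∏ j, localFeature u σ j ^ m j := by
        rw [Finset.mul_sum, Finset.mul_sum]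
        exact Finset.sum_congr rfl fun m _ => by ring
    _ = _ := by
        rw [h, localForm, neg_pow (spin σ u * _), mul_pow]
        ring

theorem abs_approxGradient_moments_sub_le {d : ℕ} {γ : ℝ} (hd : 2 * γ ≤ (d + 1 : ℕ))
    (u w : Fin p) {θ : EuclideanSpace ℝ (Fin p)} (hθ : ∑ j, |θ j| ≤ γ) :
    |approxGradient d (M.moments (statDegree d)) u θ w - M.screeningGradient u θ w| ≤
      2 * (γ ^ (d + 1) / ((d + 1).factorial : ℝ)) := by
  rw [approxGradient_moments, screeningGradient, neg_sub_neg, ← expect_sub]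
  refine abs_expect_le fun σ => ?_
  rw [← mul_sub, abs_mul, abs_mul, abs_localFeature, abs_spin, one_mul, one_mul]
  exact abs_exp_neg_sub_sum_le (abs_spin_mul_localForm_le u hθ σ) hd

end IsingModel

end Gradient

/-! ### The choice of the degree -/

/-- Stirling's lower bound with `√(2πm) ≥ 2`. The factor `2` is kept to cancel the one in the Taylor
tail bound. -/
theorem two_mul_div_exp_pow_le_factorial {m : ℕ} (hm : 1 ≤ m) :
    2 * ((m : ℝ) / Real.exp 1) ^ m ≤ (m.factorial : ℝ) := by
  refine le_trans ?_ (Stirling.le_factorial_stirling m)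
  refine mul_le_mul_of_nonneg_right ?_ (by positivity)
  refine Real.le_sqrt_of_sq_le ?_
  have hm' : (1 : ℝ) ≤ m := by exact_mod_cast hm
  nlinarith [Real.pi_gt_three]

section Degree

variable {γ ε : ℝ}

/-- The witness `w` is the Lambert value in the definition of the degree. Its argument is `(3γ + l)
/ (γe)`, so `w e ^ w = z` says that `(3γ + l) / w = γ e ^ (1 + w)`; one lower bound on the degree
thus has two readings. -/
theorem mul_exp_le_screeningDegree (hε : 0 < ε) (hεγ : ε ≤ 4 * γ) :
    ∃ w : ℝ, 0 < w ∧ γ * Real.exp (1 + w) ≤ (screeningDegree γ ε + 1 : ℕ) ∧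
      3 * γ + Real.log (16 * γ * (1 + γ) / ε ^ 2) ≤ w * (screeningDegree γ ε + 1 : ℕ) := by
  have hγ : 0 < γ := by linarith
  set l := Real.log (16 * γ * (1 + γ) / ε ^ 2) with hl
  -- This is where `ε ≤ 4γ` enters: `ε² ≤ 16γ² ≤ 16γ(1 + γ)`.
  have hl0 : 0 ≤ l := by
    refine Real.log_nonneg ?_
    rw [le_div_iff₀ (by positivity)]
    nlinarith
  set z := 3 / Real.exp 1 + l / (γ * Real.exp 1) with hz
  have hz0 : 0 < z := by positivity
  obtain ⟨-, hw⟩ := lambertW_spec (x := z) (by linarith [Real.exp_pos (-1)])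
  set w := lambertW z with hwdef
  have hw0 : 0 < w := by
    by_contra hneg
    have := mul_nonpos_of_nonpos_of_nonneg (not_lt.mp hneg) (Real.exp_pos w).le
    linarith
  have hquot : (3 * γ + l) / w = γ * Real.exp (1 + w) := by
    have hz' : 3 * γ + l = z * (γ * Real.exp 1) := by
      rw [hz]; field_simp
    rw [hz', ← hw, Real.exp_add]
    field_simp
  have hceil : (3 * γ + l) / w ≤ (screeningDegree γ ε + 1 : ℕ) := by
    refine (Nat.le_ceil _).trans ?_
    unfold screeningDegree
    rw [← hl, ← hz, ← hwdef]
    -- Natural subtraction truncates, but `k ≤ k - 1 + 1` holds even at `k = 0`.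
    exact_mod_cast (by omega : ⌈(3 * γ + l) / w⌉₊ ≤ ⌈(3 * γ + l) / w⌉₊ - 1 + 1)
  refine ⟨w, hw0, hquot ▸ hceil, ?_⟩
  rw [div_le_iff₀ hw0] at hceil
  linarith

theorem two_mul_le_screeningDegree (hε : 0 < ε) (hεγ : ε ≤ 4 * γ) :
    2 * γ ≤ (screeningDegree γ ε + 1 : ℕ) := by
  obtain ⟨w, hw, h, -⟩ := mul_exp_le_screeningDegree hε hεγ
  have h1 := Real.add_one_le_exp (1 + w)
  nlinarith

/-- By Stirling the tail is at most `(γe / m) ^ m`. The first reading of the degree makes the base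
at most `e ^ (-w)`, and the second makes `wm` large enough. -/
theorem taylor_remainder_le (hε : 0 < ε) (hεγ : ε ≤ 4 * γ) :
    2 * (γ ^ (screeningDegree γ ε + 1) / ((screeningDegree γ ε + 1).factorial : ℝ)) ≤
      Real.exp (-3 * γ) * ε ^ 2 / (16 * γ * (1 + γ)) := by
  have hγ : 0 < γ := by linarith
  obtain ⟨w, hw, h1, h2⟩ := mul_exp_le_screeningDegree hε hεγ
  set m := screeningDegree γ ε + 1 with hm
  have hm0 : (0 : ℝ) < m := lt_of_lt_of_le (by positivity) h1
  have hfac := two_mul_div_exp_pow_le_factorial (m := m) (by omega)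
  calc 2 * (γ ^ m / (m.factorial : ℝ)) ≤ 2 * (γ ^ m / (2 * ((m : ℝ) / Real.exp 1) ^ m)) := by
        gcongr
    _ = (γ * Real.exp 1 / m) ^ m := by
        rw [div_pow, div_pow, mul_pow]
        field_simp
    _ ≤ Real.exp (-w) ^ m := by
        gcongr
        rw [div_le_iff₀ hm0]
        calc γ * Real.exp 1 = Real.exp (-w) * (γ * Real.exp (1 + w)) := by
              rw [Real.exp_add, Real.exp_neg]
              field_simp
          _ ≤ Real.exp (-w) * m := by gcongr
    _ = Real.exp (-(w * m)) := by rw [← Real.exp_nat_mul]; congr 1; ring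
    _ ≤ Real.exp (-(3 * γ + Real.log (16 * γ * (1 + γ) / ε ^ 2))) :=
        Real.exp_le_exp.mpr (by linarith)
    _ = Real.exp (-3 * γ) * ε ^ 2 / (16 * γ * (1 + γ)) := by
        rw [neg_add, Real.exp_add, Real.exp_neg (Real.log _), Real.exp_log (by positivity),
          neg_mul]
        field_simp

end Degree

/-! ### The error of the algorithm on accurate statistics -/

section Deterministic

variable {p : ℕ} {γ ε : ℝ}

theorem screeningIterate_mem {D : ℕ} (d : ℕ) (S : Statistics p D) (hγ : 0 ≤ γ) (η : ℝ)
    (u : Fin p) (t : ℕ) : screeningIterate d S γ η u t ∈ l1Ball p γ := by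
  cases t with
  | zero => simpa [screeningIterate, l1Ball] using hγ
  | succ t => exact (l1Projection_spec hγ _).1

theorem inner_eq_sum_mul (a b : EuclideanSpace ℝ (Fin p)) :
    inner ℝ a b = ∑ w, a w * b w := by
  simp [PiLp.inner_apply, mul_comm]

/-- The regret of the descent with the step size and number of iterations of the algorithm. -/
theorem regret_le (hp : 0 < p) (hε : 0 < ε) (hγ : 0 < γ) :
    γ ^ 2 / (2 * screeningStepSize p γ ε) +
        screeningStepSize p γ ε * screeningIterations p γ ε * (p * Real.exp γ ^ 2) / 2 ≤
      screeningIterations p γ ε * (ε ^ 2 * Real.exp (-3 * γ) / (16 * (1 + γ))) := by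
  have hp' : (0 : ℝ) < p := by exact_mod_cast hp
  have hT : 576 * p * γ ^ 2 * Real.exp (8 * γ) * (1 + γ) ^ 2 / ε ^ 4 ≤
      (screeningIterations p γ ε : ℝ) := Nat.le_ceil _
  unfold screeningStepSize
  set T : ℝ := (screeningIterations p γ ε : ℝ) with hTdef
  have hT0 : 0 < T := lt_of_lt_of_le (by positivity) hT
  set s := Real.sqrt (p * T) with hs
  have hs0 : 0 < s := Real.sqrt_pos.mpr (by positivity)
  have hs2 : s ^ 2 = p * T := Real.sq_sqrt (by positivity)
  have hE : Real.exp γ * Real.exp (-γ) = 1 := by rw [← Real.exp_add, add_neg_cancel, Real.exp_zero]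
  -- The square root of the lower bound on `T`: `576 = 24²`.
  have hsT : s ≤ T * (ε ^ 2 * Real.exp (-4 * γ) / (24 * γ * (1 + γ))) := by
    refine Real.sqrt_le_iff.mpr ⟨by positivity, ?_⟩
    have h8 : Real.exp (8 * γ) * Real.exp (-4 * γ) ^ 2 = 1 := by
      rw [← Real.exp_nat_mul, ← Real.exp_add, ← Real.exp_zero]
      congr 1; push_cast; ring
    have h := mul_le_mul_of_nonneg_right hT
      (show 0 ≤ T * (ε ^ 2 * Real.exp (-4 * γ) / (24 * γ * (1 + γ))) ^ 2 by positivity)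
    refine le_trans (le_of_eq ?_) (h.trans (le_of_eq (by ring)))
    calc (p : ℝ) * T = p * T * (Real.exp (8 * γ) * Real.exp (-4 * γ) ^ 2) := by rw [h8, mul_one]
      _ = _ := by field_simp; ring
  have h1 : γ ^ 2 / (2 * (2 * γ * Real.exp (-γ) / (3 * s))) = 3 / 4 * (γ * Real.exp γ * s) := by
    rw [Real.exp_neg]
    field_simp
    ring
  have h2 : 2 * γ * Real.exp (-γ) / (3 * s) * T * (p * Real.exp γ ^ 2) / 2 =
      1 / 3 * (γ * Real.exp γ * s) := by
    calc _ = (Real.exp γ * Real.exp (-γ)) * γ * Real.exp γ * (p * T) / (3 * s) := by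
          field_simp
      _ = _ := by
          rw [hE, ← hs2]
          field_simp
  rw [h1, h2]
  have h3 : Real.exp γ * Real.exp (-4 * γ) = Real.exp (-3 * γ) := by
    rw [← Real.exp_add]; congr 1; ring
  -- The two regret terms have coefficients `3/4` and `1/3`, together below `3/2`; then `(3/2) / 24
  -- = 1/16`.
  calc _ ≤ 3 / 2 * (γ * Real.exp γ * s) := by
        have : 0 ≤ γ * Real.exp γ * s := by positivity
        linarith
    _ ≤ 3 / 2 * (γ * Real.exp γ * (T * (ε ^ 2 * Real.exp (-4 * γ) / (24 * γ * (1 + γ))))) := by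
        gcongr
    _ = T * (ε ^ 2 * (Real.exp γ * Real.exp (-4 * γ)) / (16 * (1 + γ))) := by
        field_simp
        ring
    _ = _ := by rw [h3]

theorem abs_screeningAlgorithm_sub_lt (M : IsingModel p) (hM : M.HasWidthLE γ) (hε : 0 < ε)
    (hεγ : ε ≤ 4 * γ) {d : ℕ} (hd : 2 * γ ≤ (d + 1 : ℕ))
    (hrem : 2 * (γ ^ (d + 1) / ((d + 1).factorial : ℝ)) ≤
      Real.exp (-3 * γ) * ε ^ 2 / (16 * γ * (1 + γ)))
    {S : Statistics p (statDegree d)} (hS1 : ∀ K, |S K| ≤ 1)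
    (hS : ∀ K, |S K - M.moments _ K| ≤ ε ^ 2 * Real.exp (-4 * γ) / (8 * γ * (1 + γ)))
    {u v : Fin p} (huv : v ≠ u) :
    |screeningAlgorithm d S γ (screeningStepSize p γ ε) (screeningIterations p γ ε) u v -
      M.coupling u v| < ε := by
  have hγ : 0 < γ := by linarith
  have hp : 0 < p := u.pos
  have hp' : (0 : ℝ) < p := by exact_mod_cast hp
  set η := screeningStepSize p γ ε with hη
  set T := screeningIterations p γ ε with hT
  have hT0 : (0 : ℝ) < T := lt_of_lt_of_le (by positivity) (Nat.le_ceil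
    (576 * p * γ ^ 2 * Real.exp (8 * γ) * (1 + γ) ^ 2 / ε ^ 4))
  have hη0 : 0 < η := by
    have : 0 < Real.sqrt (p * T) := Real.sqrt_pos.mpr (by positivity)
    rw [hη, screeningStepSize]
    positivity
  set x := screeningIterate d S γ η u with hx
  set g : ℕ → EuclideanSpace ℝ (Fin p) := fun t => approxGradient d S u (x t) with hg
  set y : EuclideanSpace ℝ (Fin p) := WithLp.toLp 2 (M.localParams u) with hy
  have hxmem : ∀ t, ∑ j, |x t j| ≤ γ := screeningIterate_mem d S hγ.le η u
  have hymem : ∑ j, |M.localParams u j| ≤ γ := M.sum_abs_localParams_le hM u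
  have hregret := (sum_inner_le_of_l1Projection (x := x) (g := g) (y := y)
    (G := p * Real.exp γ ^ 2) hγ.le hη0 rfl (fun t => rfl) hymem (fun t => by
      rw [EuclideanSpace.real_norm_sq_eq]
      calc _ ≤ ∑ _w : Fin p, Real.exp γ ^ 2 := by
            refine Finset.sum_le_sum fun w _ => ?_
            rw [← sq_abs]
            have := abs_approxGradient_le (d := d) hS1 u w (hxmem t)
            gcongr
        _ = _ := by simp) T).trans (regret_le hp hε hγ)
  -- In units of `e ^ (-3γ) ε² / (16γ(1 + γ))`, sampling contributes two and the Taylor tail one.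
  set e : ℝ := 3 * Real.exp (-3 * γ) * ε ^ 2 / (16 * γ * (1 + γ)) with he
  have hgrad : ∀ t w, |g t w - M.screeningGradient u (x t) w| ≤ e := by
    intro t w
    have h1 := abs_approxGradient_sub_le (d := d) hS (by positivity) u w (hxmem t)
    have h2 := (M.abs_approxGradient_moments_sub_le hd u w (hxmem t)).trans hrem
    have h3 : Real.exp (-4 * γ) * Real.exp γ = Real.exp (-3 * γ) := by
      rw [← Real.exp_add]; congr 1; ring
    have h4 : ε ^ 2 * Real.exp (-4 * γ) / (8 * γ * (1 + γ)) * Real.exp γ =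
        2 * (Real.exp (-3 * γ) * ε ^ 2 / (16 * γ * (1 + γ))) := by
      rw [← h3]
      field_simp
      ring
    rw [h4] at h1
    calc _ ≤ _ := abs_sub_le _ (approxGradient d (M.moments (statDegree d)) u (x t) w) _
      _ ≤ _ := add_le_add h1 h2
      _ = e := by rw [he]; ring
  set c : ℝ := Real.exp (-3 * γ) / (2 * (1 + γ)) with hc
  have hc0 : 0 < c := by positivity
  have hstep : ∀ t, c * (x t v - y v) ^ 2 ≤ inner ℝ (g t) (x t - y) + e * (2 * γ) := by
    intro t
    have h1 := (M.mul_sq_le_screeningLoss_sub hM huv (hxmem t)).trans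
      (M.screeningLoss_sub_le u (x t) (M.localParams u))
    refine h1.trans ?_
    rw [inner_eq_sum_mul, ← sub_le_iff_le_add', ← Finset.sum_sub_distrib]
    calc _ ≤ ∑ w, e * (|x t w| + |M.localParams u w|) := by
          refine Finset.sum_le_sum fun w _ => ?_
          have h2 : M.screeningGradient u (x t) w * (x t w - M.localParams u w) -
              g t w * (x t - y) w =
              -(g t w - M.screeningGradient u (x t) w) * (x t w - M.localParams u w) := by
            simp only [hy, PiLp.sub_apply]
            ring
          rw [h2]
          refine (le_abs_self _).trans ?_
          rw [abs_mul, abs_neg]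
          exact mul_le_mul (hgrad t w) (abs_sub _ _) (abs_nonneg _) (by positivity)
      _ = e * (∑ w, |x t w| + ∑ w, |M.localParams u w|) := by
          rw [← Finset.mul_sum, Finset.sum_add_distrib]
      _ ≤ e * (2 * γ) := by
          refine mul_le_mul_of_nonneg_left ?_ (by positivity)
          linarith [hxmem t]
  -- In units of `e ^ (-3γ) ε² / (16(1 + γ))`, the average regret is `1`, the gradient error times
  -- `2γ` is `6`, and `c ε²` is `8`; hence `7/8`. The slack makes the final bound strict, as zero
  -- couplings require when `ε = α / 2`.
  have hsum : ∑ t ∈ Finset.range T, (x t v - y v) ^ 2 ≤ T * (7 / 8 * ε ^ 2) := by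
    have h1 := Finset.sum_le_sum fun t (_ : t ∈ Finset.range T) => hstep t
    rw [← Finset.mul_sum, Finset.sum_add_distrib, Finset.sum_const, Finset.card_range,
      nsmul_eq_mul] at h1
    have h2 : c * ∑ t ∈ Finset.range T, (x t v - y v) ^ 2 ≤ c * (T * (7 / 8 * ε ^ 2)) := by
      refine (h1.trans (add_le_add_left hregret _)).trans (le_of_eq ?_)
      rw [hc, he]
      field_simp
      ring
    exact le_of_mul_le_mul_left h2 hc0
  have hcs := sq_sum_le_card_mul_sum_sq (s := Finset.range T) (f := fun t => x t v - y v)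
  rw [Finset.card_range] at hcs
  have hout : screeningAlgorithm d S γ η T u v - M.coupling u v =
      (∑ t ∈ Finset.range T, (x t v - y v)) / T := by
    have hyv : y v = M.coupling u v := by simp [hy, IsingModel.localParams, huv]
    have hxv : screeningAlgorithm d S γ η T u v =
        (T : ℝ)⁻¹ * ∑ t ∈ Finset.range T, x t v := by
      simp [screeningAlgorithm, hx]
    rw [hxv, Finset.sum_sub_distrib, Finset.sum_const, Finset.card_range, nsmul_eq_mul, hyv]
    field_simp
  rw [hout]
  refine abs_lt_of_sq_lt_sq ?_ hε.le
  rw [div_pow, div_lt_iff₀ (by positivity)]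
  calc _ ≤ (T : ℝ) * (T * (7 / 8 * ε ^ 2)) := hcs.trans (by gcongr)
    _ < ε ^ 2 * T ^ 2 := by
      have : 0 < ε ^ 2 * (T : ℝ) ^ 2 := by positivity
      nlinarith

end Deterministic

/-! ### Concentration of the empirical statistics -/

instance Int.units_measurableSingletonClass : MeasurableSingletonClass ℤˣ where
  measurableSet_singleton a := by
    refine ⟨{(a : ℤ)}, measurableSet_singleton _, ?_⟩
    ext b
    simp [Units.ext_iff]

section Concentration

variable {p : ℕ} {M : IsingModel p}

theorem IsingModel.integral_gibbsMeasure (f : SpinConfig p → ℝ) :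
    ∫ σ, f σ ∂M.gibbsMeasure = M.expect f := by
  rw [gibbsMeasure, integral_finsetSum_measure]
  · simp only [integral_smul_measure, integral_dirac, expect, smul_eq_mul]
    exact Finset.sum_congr rfl fun σ _ => by rw [ENNReal.toReal_ofReal (M.gibbsProb_pos σ).le]
  · intro σ _
    exact (integrable_dirac (by simp)).smul_measure ENNReal.ofReal_ne_top

variable {Ω : Type*} [MeasurableSpace Ω] {P : Measure Ω} [IsProbabilityMeasure P]

/-- Hoeffding's inequality: values in `[-1, 1]` give sub-Gaussian parameter `((1 - (-1)) / 2)² = 1`.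
-/
theorem measure_sum_sub_expect_ge_le {n : ℕ} {X : Fin n → Ω → SpinConfig p}
    (hlaw : ∀ t, HasLaw (X t) M.gibbsMeasure P) (hind : iIndepFun X P)
    {f : SpinConfig p → ℝ} (hf : ∀ σ, |f σ| ≤ 1) {τ : ℝ} (hτ : 0 ≤ τ) :
    P.real {ω | n * τ ≤ ∑ t, (f (X t ω) - M.expect f)} ≤ Real.exp (-(n * τ ^ 2 / 2)) := by
  have hmeas : Measurable f := Measurable.of_discrete
  have hmean : ∀ t, ∫ ω, f (X t ω) ∂P = M.expect f := fun t => by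
    rw [← M.integral_gibbsMeasure]
    exact (hlaw t).integral_comp hmeas.aestronglyMeasurable
  have hsub : ∀ t, HasSubgaussianMGF (fun ω => f (X t ω) - M.expect f) 1 P := fun t => by
    have h := hasSubgaussianMGF_of_mem_Icc (X := fun ω => f (X t ω)) (μ := P) (a := -1) (b := 1)
      (hmeas.comp_aemeasurable (hlaw t).aemeasurable)
      (Filter.Eventually.of_forall fun ω => abs_le.mp (hf _))
    rw [hmean t] at h
    convert h using 1
    ext
    norm_num
  have hind' : iIndepFun (fun t ω => f (X t ω) - M.expect f) P :=
    hind.comp (fun _ σ => f σ - M.expect f) fun _ => hmeas.sub_const _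
  have h := HasSubgaussianMGF.measure_sum_ge_le_of_iIndepFun hind' (s := Finset.univ)
    (c := fun _ => 1) (fun t _ => hsub t) (ε := n * τ) (by positivity)
  refine h.trans (le_of_eq ?_)
  congr 1
  rcases Nat.eq_zero_or_pos n with rfl | hn
  · simp
  · have : (0 : ℝ) < n := by exact_mod_cast hn
    simp
    field_simp

theorem abs_prod_spin (σ : SpinConfig p) (K : Finset (Fin p)) : |∏ u ∈ K, spin σ u| = 1 := by
  rw [Finset.abs_prod]
  exact Finset.prod_eq_one fun u _ => abs_spin σ u

theorem abs_empiricalStatistics_le {D n : ℕ} (x : MonomialIndex p D → Fin n → SpinConfig p)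
    (K : MonomialIndex p D) : |empiricalStatistics x K| ≤ 1 := by
  rw [empiricalStatistics, abs_div, Nat.abs_cast]
  refine div_le_one_of_le₀ ?_ (Nat.cast_nonneg n)
  refine (Finset.abs_sum_le_sum_abs _ _).trans (le_of_eq ?_)
  simp [abs_prod_spin]

theorem measure_empiricalStatistics_sub_ge_le {D n : ℕ}
    {X : MonomialIndex p D → Fin n → Ω → SpinConfig p} (K : MonomialIndex p D)
    (hlaw : ∀ t, HasLaw (X K t) M.gibbsMeasure P) (hind : iIndepFun (X K) P)
    {τ : ℝ} (hτ : 0 ≤ τ) :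
    P.real {ω | τ ≤ |empiricalStatistics (fun K t => X K t ω) K - M.moments D K|} ≤
      2 * Real.exp (-(n * τ ^ 2 / 2)) := by
  -- Without samples the empirical mean is the junk value of a division by zero, but the claimed
  -- bound is then `2`.
  rcases Nat.eq_zero_or_pos n with rfl | hn
  · refine measureReal_le_one.trans ?_
    norm_num
  have hn' : (0 : ℝ) < n := by exact_mod_cast hn
  set f : SpinConfig p → ℝ := fun σ => ∏ u ∈ K.1, spin σ u with hf
  have h1 := measure_sum_sub_expect_ge_le hlaw hind (f := f) (fun σ => (abs_prod_spin σ K.1).le) hτ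
  have h2 := measure_sum_sub_expect_ge_le hlaw hind (f := fun σ => (-1) * f σ)
    (fun σ => by rw [abs_mul, abs_neg, abs_one, one_mul]; exact (abs_prod_spin σ K.1).le) hτ
  have hdiff : ∀ ω, ∑ t, (f (X K t ω) - M.expect f) =
      n * (empiricalStatistics (fun K t => X K t ω) K - M.moments D K) := by
    intro ω
    rw [Finset.sum_sub_distrib, Finset.sum_const, Finset.card_univ, Fintype.card_fin,
      nsmul_eq_mul, mul_sub, empiricalStatistics, IsingModel.moments]
    rw [mul_div_cancel₀ _ hn'.ne']
  have hsub : {ω | τ ≤ |empiricalStatistics (fun K t => X K t ω) K - M.moments D K|} ⊆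
      {ω | n * τ ≤ ∑ t, (f (X K t ω) - M.expect f)} ∪
      {ω | n * τ ≤ ∑ t, ((-1) * f (X K t ω) - M.expect fun σ => (-1) * f σ)} := by
    intro ω hω
    have hω' : τ ≤ |empiricalStatistics (fun K t => X K t ω) K - M.moments D K| := hω
    rcases le_abs.mp hω' with h | h
    · left
      change n * τ ≤ ∑ t, (f (X K t ω) - M.expect f)
      rw [hdiff]
      gcongr
    · right
      change n * τ ≤ ∑ t, ((-1) * f (X K t ω) - M.expect fun σ => (-1) * f σ)
      simp only [IsingModel.expect_const_mul, ← mul_sub]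
      rw [← Finset.mul_sum, hdiff]
      nlinarith
  calc _ ≤ _ := measureReal_mono hsub
    _ ≤ _ := measureReal_union_le _ _
    _ ≤ _ := add_le_add h1 h2
    _ = _ := by ring

theorem card_monomialIndex_le (hp : 0 < p) (D : ℕ) :
    Fintype.card (MonomialIndex p D) ≤ (D + 1) * p ^ D := by
  rw [Fintype.card_subtype]
  have hsub : (Finset.univ.filter fun K : Finset (Fin p) => K.card ≤ D) ⊆
      (Finset.range (D + 1)).biUnion fun k => Finset.powersetCard k Finset.univ := by
    intro K hK
    simp only [Finset.mem_filter, Finset.mem_univ, true_and] at hK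
    simp only [Finset.mem_biUnion, Finset.mem_range, Finset.mem_powersetCard, Finset.subset_univ,
      true_and, exists_eq_right']
    omega
  calc _ ≤ _ := Finset.card_le_card hsub
    _ ≤ ∑ k ∈ Finset.range (D + 1), (Finset.powersetCard k (Finset.univ : Finset (Fin p))).card :=
        Finset.card_biUnion_le
    _ ≤ ∑ _k ∈ Finset.range (D + 1), p ^ D := by
        refine Finset.sum_le_sum fun k hk => ?_
        rw [Finset.card_powersetCard, Finset.card_univ, Fintype.card_fin]
        exact (Nat.choose_le_pow p k).trans
          (Nat.pow_le_pow_right hp (Nat.lt_succ_iff.mp (Finset.mem_range.mp hk)))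
    _ = _ := by simp

theorem card_mul_exp_le {γ ε δ : ℝ} (hp : 0 < p) (hγ : 0 < γ) (hε : 0 < ε) (hδ : 0 < δ) :
    Fintype.card (MonomialIndex p (statDegree (screeningDegree γ ε))) *
      (2 * Real.exp (-(screeningSampleSize p γ ε δ *
        (ε ^ 2 * Real.exp (-4 * γ) / (8 * γ * (1 + γ))) ^ 2 / 2))) ≤ δ * p := by
  have hp' : (1 : ℝ) ≤ p := by exact_mod_cast hp
  have hp0 : (0 : ℝ) < p := by linarith
  set d := screeningDegree γ ε with hd
  set B : ℝ := ((d : ℝ) + 2) * Real.log (Real.exp 1 * p) + Real.log (2 * p * ((d : ℝ) + 2) / δ)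
    with hB
  have hn : 2 ^ 7 * Real.exp (8 * γ) * γ ^ 2 * (1 + γ) ^ 2 * B / ε ^ 4 ≤
      (screeningSampleSize p γ ε δ : ℝ) := Nat.le_ceil _
  set n : ℝ := (screeningSampleSize p γ ε δ : ℝ)
  have h8 : Real.exp (8 * γ) * Real.exp (-4 * γ) ^ 2 = 1 := by
    rw [← Real.exp_nat_mul, ← Real.exp_add, ← Real.exp_zero]
    congr 1; push_cast; ring
  -- The squared tolerance halved has denominator `2 · 8² = 2⁷` times `γ²(1 + γ)²`, matching the
  -- sample size. Nothing here needs `B` to be nonnegative.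
  have hBn : B ≤ n * (ε ^ 2 * Real.exp (-4 * γ) / (8 * γ * (1 + γ))) ^ 2 / 2 := by
    have h := mul_le_mul_of_nonneg_right hn
      (show 0 ≤ (ε ^ 2 * Real.exp (-4 * γ) / (8 * γ * (1 + γ))) ^ 2 / 2 by positivity)
    refine le_trans (le_of_eq ?_) (h.trans (le_of_eq (by ring)))
    calc B = B * (Real.exp (8 * γ) * Real.exp (-4 * γ) ^ 2) := by rw [h8, mul_one]
      _ = _ := by field_simp; ring
  have hexpB : Real.exp B = (Real.exp 1 * p) ^ (d + 2) * (2 * p * ((d : ℝ) + 2) / δ) := by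
    rw [hB, Real.exp_add, Real.exp_log (by positivity),
      show ((d : ℝ) + 2) = ((d + 2 : ℕ) : ℝ) by push_cast; ring, Real.exp_nat_mul,
      Real.exp_log (by positivity)]
  have hcard : (Fintype.card (MonomialIndex p (statDegree d)) : ℝ) ≤
      (Real.exp 1 * p) ^ (d + 2) := by
    have hD : statDegree d ≤ d + 2 := by unfold statDegree; omega
    have h1 : Fintype.card (MonomialIndex p (statDegree d)) ≤ (d + 2 + 1) * p ^ (d + 2) :=
      (card_monomialIndex_le hp _).trans
        (Nat.mul_le_mul (by omega) (Nat.pow_le_pow_right hp hD))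
    -- The `d + 3` possible sizes of an index set are absorbed by `e ^ (d + 2)`, which explains `log
    -- (ep)` in the sample size.
    have h2 : ((d + 2 : ℕ) : ℝ) + 1 ≤ Real.exp 1 ^ (d + 2) := by
      rw [← Real.exp_nat_mul, mul_one]
      exact Real.add_one_le_exp _
    calc _ ≤ (((d + 2 + 1) * p ^ (d + 2) : ℕ) : ℝ) := by exact_mod_cast h1
      _ = (((d + 2 : ℕ) : ℝ) + 1) * (p : ℝ) ^ (d + 2) := by push_cast; ring
      _ ≤ Real.exp 1 ^ (d + 2) * (p : ℝ) ^ (d + 2) := by gcongr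
      _ = _ := by rw [mul_pow]
  calc _ ≤ (Real.exp 1 * p) ^ (d + 2) * (2 * Real.exp (-B)) := by gcongr
    _ = δ / (p * (d + 2)) := by
        rw [Real.exp_neg, hexpB]
        field_simp
    _ ≤ δ := div_le_self hδ.le (by nlinarith [(Nat.cast_nonneg d : (0 : ℝ) ≤ d)])
    _ ≤ δ * p := le_mul_of_one_le_right hδ.le hp'

end Concentration

/-! ### Structure recovery -/

theorem thresholdEdges_eq_edges {p : ℕ} (M : IsingModel p) {α : ℝ}
    (hsep : ∀ e ∈ M.edges, α ≤ |M.coupling e.1 e.2|) {θhat : Fin p → Fin p → ℝ}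
    (hle : ∀ u v, u ≠ v → |θhat u v - M.coupling u v| ≤ α / 2)
    (hlt : ∀ u v, u ≠ v → M.coupling u v = 0 → |θhat u v - M.coupling u v| < α / 2) :
    thresholdEdges α θhat = M.edges := by
  ext ⟨u, v⟩
  change (u ≠ v ∧ α / 2 ≤ |θhat u v|) ↔ (u ≠ v ∧ M.coupling u v ≠ 0)
  refine and_congr_right fun huv => ⟨fun h h0 => ?_, fun h => ?_⟩
  · have := hlt u v huv h0
    rw [h0, sub_zero] at this
    linarith
  · have h1 : α ≤ |M.coupling u v| := hsep (u, v) ⟨huv, h⟩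
    have h2 := hle u v huv
    have h3 := abs_sub_abs_le_abs_sub (M.coupling u v) (θhat u v)
    rw [abs_sub_comm] at h3
    linarith

theorem theorem2 {p : ℕ} (M : IsingModel p) (α : ℝ) (hα : 0 < α)
    (hsep : ∀ e ∈ M.edges, α ≤ |M.coupling e.1 e.2|) :
    (∀ θhat : Fin p → Fin p → ℝ,
      (∀ u v, u ≠ v → |θhat u v - M.coupling u v| ≤ α / 2) →
      (∀ u v, u ≠ v → M.coupling u v = 0 → |θhat u v - M.coupling u v| < α / 2) →
      thresholdEdges α θhat = M.edges) ∧
    (∀ γ ε δ : ℝ, M.HasWidthLE γ → 0 < ε → ε ≤ 4 * γ → ε ≤ α / 2 → 0 < δ →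
      ∀ (Ω : Type*) [MeasurableSpace Ω] (P : Measure Ω) [IsProbabilityMeasure P]
        (X : MonomialIndex p (statDegree (screeningDegree γ ε)) →
          Fin (screeningSampleSize p γ ε δ) → Ω → SpinConfig p),
        (∀ K t, HasLaw (X K t) M.gibbsMeasure P) →
        (∀ K, iIndepFun (X K) P) →
        1 - δ * p ≤ P.real {ω |
          thresholdEdges α
            (screeningAlgorithm (screeningDegree γ ε)
              (empiricalStatistics (fun K t => X K t ω)) γ
              (screeningStepSize p γ ε) (screeningIterations p γ ε)) = M.edges}) := by
  refine ⟨fun θhat hle hlt => thresholdEdges_eq_edges M hsep hle hlt, ?_⟩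
  intro γ ε δ hM hε hεγ hεα hδ Ω _ P _ X hlaw hind
  rcases Nat.eq_zero_or_pos p with rfl | hp
  · have huniv : {ω | thresholdEdges α
        (screeningAlgorithm (screeningDegree γ ε) (empiricalStatistics (fun K t => X K t ω)) γ
          (screeningStepSize 0 γ ε) (screeningIterations 0 γ ε)) = M.edges} = Set.univ :=
      Set.eq_univ_of_forall fun ω => Set.ext fun e => e.1.elim0
    rw [huniv]
    simp
  have hγ : 0 < γ := by linarith
  -- This tolerance, amplified by `e ^ γ` in the gradient, is exactly twice the bound on the Taylor
  -- tail.
  set τ : ℝ := ε ^ 2 * Real.exp (-4 * γ) / (8 * γ * (1 + γ)) with hτ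
  set good := {ω | thresholdEdges α
    (screeningAlgorithm (screeningDegree γ ε) (empiricalStatistics (fun K t => X K t ω)) γ
      (screeningStepSize p γ ε) (screeningIterations p γ ε)) = M.edges}
  set bad := ⋃ K, {ω | τ ≤ |empiricalStatistics (fun K t => X K t ω) K - M.moments _ K|}
    with hbad
  have hcover : (Set.univ : Set Ω) ⊆ good ∪ bad := by
    intro ω _
    by_cases hω : ω ∈ bad
    · exact Or.inr hω
    · left
      have hS : ∀ K, |empiricalStatistics (fun K t => X K t ω) K - M.moments _ K| ≤ τ :=
        fun K => le_of_not_ge fun h => hω (Set.mem_iUnion.mpr ⟨K, h⟩)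
      have herr := fun u v (huv : u ≠ v) => (abs_screeningAlgorithm_sub_lt M hM hε hεγ
        (two_mul_le_screeningDegree hε hεγ) (taylor_remainder_le hε hεγ)
        (abs_empiricalStatistics_le _) hS huv.symm).trans_le hεα
      exact thresholdEdges_eq_edges M hsep (fun u v huv => (herr u v huv).le)
        fun u v huv _ => herr u v huv
  have hbadle : P.real bad ≤ δ * p := by
    refine (measureReal_iUnion_fintype_le _).trans ?_
    refine (Finset.sum_le_sum fun K _ => measure_empiricalStatistics_sub_ge_le K (hlaw K) (hind K)
      (show 0 ≤ τ by positivity)).trans ?_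
    rw [Finset.sum_const, Finset.card_univ, nsmul_eq_mul]
    exact card_mul_exp_le hp hγ hε hδ
  -- Subadditivity suffices, so the events need not be measurable.
  have h1 : 1 ≤ P.real good + P.real bad := by
    rw [← probReal_univ (μ := P)]
    exact (measureReal_mono hcover).trans (measureReal_union_le _ _)
  linarith
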